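/- **Conventions.** An $n$-dimensional *matchbox manifold* is a compact connected metrizable space $\mathfrak M$ with a smooth foliated atlas: it is covered by charts $U\cong(-1,1)^n\times T$, with $U$ open and $T$ compact and totally disconnected, whose transition maps are $C^\infty$ along the plaques with all leafwise derivatives continuous. Its *leaves* are its path components, each with the leaf topology (generated by the path components of the open subsets of $\mathfrak M$). A *presentation* is a sequence $\mathcal P=\{p_{\ell+1}:M_{\ell+1}\to M_\ell\mid \ell\ge 0\}$ of covering maps of finite degree $>1$ between compact connected $n$-manifolds without boundary, and $\mathcal S_{\mathcal P}=\varprojlim M_\ell$ is the associated *weak solenoid*. Put $q_\ell=p_1\circ\cdots\circ p_\ell:M_\ell\to M_0$. For $x=(x_\ell)\in\mathcal S_{\mathcal P}$ the *group chain* at $x$ is $G_\ell=(q_\ell)_\#\pi_1(M_\ell,x_\ell)\subseteq G_0=\pi_1(M_0,x_0)$, its *cores* are $C_\ell=\bigcap_{g\in G_0}gG_\ell g^{-1}$, and the *discriminant group* is $\mathcal D_x=\varprojlim G_\ell/C_\ell$, with the inverse limit topology of the discrete groups $G_\ell/C_\ell$. **Theorem.** Let $\mathfrak M$ be an $n$-dimensional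 matchbox manifold, let $\mathcal P$ be a presentation by $n$-manifolds with a homeomorphism $h:\mathfrak M\to\mathcal S_{\mathcal P}$ (in particular, $\mathfrak M$ is equicontinuous; conversely, every equicontinuous matchbox manifold is homeomorphic to a weak solenoid), and let $x\in\mathcal S_{\mathcal P}$. Then: 1. $\mathcal D_x$ is a compact, Hausdorff, totally disconnected topological group. 2. There are a sequence of covering maps $\hat p_{\ell+1}:\widehat M_{\ell+1}\to\widehat M_\ell$ ($\ell\ge0$) between compact connected $n$-manifolds without boundary, a point $z=(z_\ell)\in\varprojlim\widehat M_\ell$, and covering maps $r_\ell:\widehat M_\ell\to M_\ell$ with $r_\ell\circ\hat p_{\ell+1}=p_{\ell+1}\circ r_{\ell+1}$ and $r_\ell(z_\ell)=x_\ell$, such that $\hat q_\ell=q_\ell\circ r_\ell:\widehat M_\ell\to M_0$ is the normal covering attached to the core $C_\ell$, that is, $(\hat q_\ell)_\#\pi_1(\widehat M_\ell,z_\ell)=C_\ell$ for all $\ell\geq 0$. 3. The *Molino space* $\widehat{\mathfrak M}=\varprojlim\widehat M_\ell$ of this sequence is an $n$-dimensional matchbox manifold, and it is homogeneous: for any two of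 its points some homeomorphism of $\widehat{\mathfrak M}$ takes one to the other. 4. The continuous map $\hat q:\widehat{\mathfrak M}\to\mathfrak M$ induced by the maps $r_\ell$ (so that the $\ell$-th coordinate of $h(\hat q(w))$ is $r_\ell(w_\ell)$ for all $w\in\widehat{\mathfrak M}$ and $\ell\ge0$) is a principal $\mathcal D_x$-bundle $$\mathcal D_x\longrightarrow\widehat{\mathfrak M}\stackrel{\hat q}{\longrightarrow}\mathfrak M ,$$ that is, for some continuous fibre-preserving action of $\mathcal D_x$ on $\widehat{\mathfrak M}$ it is locally trivial, by trivializations with fibre $\mathcal D_x$ that turn the action into translation in $\mathcal D_x$. 5. For every leaf $\widehat L$ of $\widehat{\mathfrak M}$ there is a leaf $L$ of $\mathfrak M$ such that $\hat q$ restricts to a surjective covering map $\widehat L\to L$. -/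

import Mathlib

open scoped ContDiff

universe u

/-! ### Matchbox manifolds and their leaves -/

/-- A foliation chart of dimension `n` on `X`: a homeomorphism from an open subset of `X` onto
`(-1,1)^n × T`, where the local transverse model `T` is compact and totally disconnected. (In a
compact metrizable space, covering by such open charts is the same as covering by the interiors of
closed charts `[-1,1]^n × T`, as one sees by shrinking and rescaling the cube.) -/
structure FoliationChart (n : ℕ) (X : Type u) [TopologicalSpace X] where
  /-- The local transverse model. -/
  T : Type u
  [topologicalSpace : TopologicalSpace T]
  [compactSpace : CompactSpace T]
  [totallyDisconnectedSpace : TotallyDisconnectedSpace T]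
  /-- The coordinate map. -/
  chart : OpenPartialHomeomorph X (EuclideanSpace ℝ (Fin n) × T)
  target_eq : chart.target = {v | ∀ i, v i ∈ Set.Ioo (-1 : ℝ) 1} ×ˢ Set.univ

attribute [instance] FoliationChart.topologicalSpace FoliationChart.compactSpace
  FoliationChart.totallyDisconnectedSpace

namespace FoliationChart

variable {n : ℕ} {X : Type u} [TopologicalSpace X]

/-- The domain of the change of coordinates from `c` to `c'`. -/
def overlap (c c' : FoliationChart n X) : Set (EuclideanSpace ℝ (Fin n) × c.T) :=
  (c.chart.symm.trans c'.chart).source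

/-- The leaf component of the change of coordinates from `c` to `c'`. -/
def leafTransition (c c' : FoliationChart n X) (z : EuclideanSpace ℝ (Fin n) × c.T) :
    EuclideanSpace ℝ (Fin n) :=
  (c'.chart (c.chart.symm z)).1

/-- The change of coordinates from `c` to `c'` is `C^∞` along the plaques, and all its leafwise
derivatives depend continuously on the point, in particular on the transverse parameter. -/
structure SmoothTransition (c c' : FoliationChart n X) : Prop where
  contDiffOn : ∀ t : c.T,
    ContDiffOn ℝ ∞ (fun v => c.leafTransition c' (v, t)) {v | (v, t) ∈ c.overlap c'}
  continuousOn : ∀ k : ℕ,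
    ContinuousOn (fun z : EuclideanSpace ℝ (Fin n) × c.T =>
      iteratedFDeriv ℝ k (fun v => c.leafTransition c' (v, z.2)) z.1) (c.overlap c')

end FoliationChart

/-- `X` is a (smooth) `n`-dimensional matchbox manifold: a compact connected metrizable space that
is covered by smoothly compatible foliation charts with totally disconnected transversals. -/
structure IsMatchboxManifold (n : ℕ) (X : Type u) [TopologicalSpace X] : Prop where
  compactSpace : CompactSpace X
  connectedSpace : ConnectedSpace X
  metrizableSpace : TopologicalSpace.MetrizableSpace X
  exists_atlas : ∃ A : Set (FoliationChart n X),
    (∀ x, ∃ c ∈ A, x ∈ c.chart.source) ∧ ∀ c ∈ A, ∀ c' ∈ A, c.SmoothTransition c'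

/-- Any two points are exchanged by a homeomorphism of the space. -/
def IsHomogeneousSpace (X : Type u) [TopologicalSpace X] : Prop :=
  ∀ x y : X, ∃ f : X ≃ₜ X, f x = y

/-- The leaf topology on a foliated space `X`, generated by the path components of the open subsets
of `X`. For a matchbox manifold it is generated by the open subsets of the plaques of the charts,
because the path components of `(-1,1)^n × T` are the sets `(-1,1)^n × {t}`. -/
@[reducible]
def leafTopology (X : Type u) [TopologicalSpace X] : TopologicalSpace X :=
  TopologicalSpace.generateFrom {s | ∃ U : Set X, IsOpen U ∧ ∃ x ∈ U, s = pathComponentIn U x}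

/-- The leaf through `x`: the path component of `x`, with the leaf topology (not with the coarser
topology induced from `X`). -/
def Leaf {X : Type u} [TopologicalSpace X] (x : X) : Type u :=
  {y : X // y ∈ pathComponent x}

instance {X : Type u} [TopologicalSpace X] (x : X) : TopologicalSpace (Leaf x) :=
  (leafTopology X).induced Subtype.val

/-- The restriction of a continuous map to the leaf through `x`, as a map to the leaf through the
image of `x`. -/
def leafMap {X Y : Type u} [TopologicalSpace X] [TopologicalSpace Y] (q : C(X, Y)) (x : X) :
    Leaf x → Leaf (q x) :=
  fun y => ⟨q y.1, Joined.map y.2 q.continuous⟩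

/-! ### Towers of coverings and weak solenoids -/

/-- A compact connected `n`-dimensional topological manifold without boundary. -/
structure IsClosedManifold (n : ℕ) (X : Type u) [TopologicalSpace X] : Prop where
  compactSpace : CompactSpace X
  connectedSpace : ConnectedSpace X
  t2Space : T2Space X
  chartedSpace : Nonempty (ChartedSpace (EuclideanSpace ℝ (Fin n)) X)

/-- A sequence of covering maps `M 0 ← M 1 ← M 2 ← ⋯` between closed connected `n`-manifolds. -/
structure CoveringTower (n : ℕ) where
  /-- The manifolds. -/
  M : ℕ → Type u
  [topologicalSpace : ∀ l, TopologicalSpace (M l)]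
  isClosedManifold : ∀ l, IsClosedManifold n (M l)
  /-- The bonding maps. -/
  p : ∀ l, C(M (l + 1), M l)
  isCoveringMap : ∀ l, IsCoveringMap (p l)

attribute [instance] CoveringTower.topologicalSpace

namespace CoveringTower

variable {n : ℕ} (P : CoveringTower.{u} n)

/-- The inverse limit of the tower, as a subspace of the product. -/
def Limit : Type u :=
  {x : ∀ l, P.M l // ∀ l, P.p l (x (l + 1)) = x l}

instance : TopologicalSpace P.Limit :=
  inferInstanceAs (TopologicalSpace {x : ∀ l, P.M l // ∀ l, P.p l (x (l + 1)) = x l})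

variable {P} in
/-- The `l`-th coordinate of a point of the inverse limit. -/
def Limit.coord (x : P.Limit) (l : ℕ) : P.M l :=
  x.1 l

/-- The composed covering `M l → M 0`. -/
def q : ∀ l, C(P.M l, P.M 0)
  | 0 => ContinuousMap.id _
  | l + 1 => (q l).comp (P.p l)

theorem q_coord (x : P.Limit) (l : ℕ) : P.q l (x.coord l) = x.coord 0 := by
  induction l with
  | zero => rfl
  | succ l ih =>
    have h : P.p l (x.coord (l + 1)) = x.coord l := x.2 l
    rw [q, ContinuousMap.comp_apply, h, ih]

/-- The group chain at `x`: the images of `π₁(M l, x l)` in `π₁(M 0, x 0)`. -/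
noncomputable def groupChain (x : P.Limit) (l : ℕ) :
    Subgroup (FundamentalGroup (P.M 0) (x.coord 0)) :=
  (FundamentalGroup.mapOfEq (P.q l) (P.q_coord x l)).range

end CoveringTower

/-- A presentation of a weak solenoid: a tower of coverings of closed connected manifolds, each of
finite degree `> 1`. The weak solenoid that it defines is its inverse limit. -/
structure Presentation (n : ℕ) extends CoveringTower.{u} n where
  one_lt_degree : ∀ l, ∃ m : ℕ, 1 < m ∧ ∀ y, Nat.card (p l ⁻¹' {y}) = m

/-! ### The discriminant group of a group chain -/

section Discriminant

variable {Γ : Type u} [Group Γ]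

/-- For a descending chain `G` of subgroups of `Γ` with cores `C l`: the inverse limit of the groups
`Γ ⧸ C l`, i.e. the sequences of cosets in which the coset modulo `C (l + 1)` is sent to the coset
modulo `C l` by the canonical projection `g C (l + 1) ↦ g C l`. -/
def coreLimit (G : ℕ → Subgroup Γ) : Subgroup (∀ l, Γ ⧸ (G l).normalCore) where
  carrier := {c | ∀ l, ∃ g : Γ,
    c (l + 1) = (g : Γ ⧸ (G (l + 1)).normalCore) ∧ c l = (g : Γ ⧸ (G l).normalCore)}
  mul_mem' := by
    intro a b ha hb l
    obtain ⟨g, hg, hg'⟩ := ha l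
    obtain ⟨k, hk, hk'⟩ := hb l
    exact ⟨g * k, by simp [hg, hk], by simp [hg', hk']⟩
  one_mem' := fun l => ⟨1, by simp, by simp⟩
  inv_mem' := by
    intro a ha l
    obtain ⟨g, hg, hg'⟩ := ha l
    exact ⟨g⁻¹, by simp [hg], by simp [hg']⟩

/-- The subgroup of the sequences in `coreLimit G` whose `l`-th term lies in `G l ⧸ C l`. -/
def discriminantSubgroup (G : ℕ → Subgroup Γ) : Subgroup (∀ l, Γ ⧸ (G l).normalCore) :=
  coreLimit G ⊓ Subgroup.pi Set.univ fun l => (G l).map (QuotientGroup.mk' (G l).normalCore)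

/-- The discriminant group of a descending chain `G` of subgroups of `Γ`: the inverse limit of the
groups `G l ⧸ C l`, where `C l` is the core of `G l` in `Γ`. -/
def Discriminant (G : ℕ → Subgroup Γ) : Type u :=
  discriminantSubgroup G

instance (G : ℕ → Subgroup Γ) : Group (Discriminant G) :=
  inferInstanceAs (Group (discriminantSubgroup G))

/-- The inverse limit topology: the subspace topology of the product of the discrete quotients. -/
instance (G : ℕ → Subgroup Γ) : TopologicalSpace (Discriminant G) :=
  TopologicalSpace.induced (fun d : Discriminant G => d.1)
    (@Pi.topologicalSpace ℕ (fun l => Γ ⧸ (G l).normalCore) fun _ => ⊥)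

end Discriminant

/-! ### Principal bundles and the tower of the cores -/

/-- `q : E → B` is a principal `D`-bundle: `D` acts continuously on `E`, preserving the fibres, and
`q` is locally trivial with fibre `D`, by trivializations that turn the action into translation in
the fibre. -/
structure IsPrincipalBundle (D : Type u) {E B : Type u} [Group D] [TopologicalSpace D]
    [TopologicalSpace E] [TopologicalSpace B] [MulAction D E] (q : E → B) : Prop where
  continuousSMul : ContinuousSMul D E
  proj_smul : ∀ (d : D) (z : E), q (d • z) = q z
  exists_trivialization : ∀ b : B, ∃ e : Bundle.Trivialization D q, b ∈ e.baseSet ∧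
    ∀ (d : D) (z : E), q z ∈ e.baseSet → (e (d • z)).2 = d * (e z).2

/-- `Q` is the tower of the coverings of `P.M 0` attached to the cores of the group chain of `P`
at `x`: its `l`-th space, with base point `z l`, lies over `P.M l` by a covering `r l` such that the
composed covering `Q.M l → P.M l → P.M 0` has the core of `P.groupChain x l` as its group, and the
maps `r l` are compatible with the bonding maps and base points of the two towers. -/
structure IsCoreTower {n : ℕ} (P : CoveringTower.{u} n) (x : P.Limit) (Q : CoveringTower.{u} n)
    (z : Q.Limit) (r : ∀ l, C(Q.M l, P.M l)) : Prop where
  isCoveringMap : ∀ l, IsCoveringMap (r l)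
  comm : ∀ l y, r l (Q.p l y) = P.p l (r (l + 1) y)
  base : ∀ l, r l (z.coord l) = x.coord l
  range_eq : ∀ l,
    (FundamentalGroup.mapOfEq ((P.q l).comp (r l)) (x := z.coord l) (y := x.coord 0)
      ((congrArg (P.q l) (base l)).trans (P.q_coord x l))).range = (P.groupChain x l).normalCore

open Set Topology unitInterval

/-! ### Fibrations with unique path lifting -/

/-! Everything is compared over `M 0`. The projection of a limit of coverings to `M 0` need not be a
covering, but it lifts homotopies, with unique lifts of paths
(`CoveringTower.isUniqueFibration_coord_zero`). Over a contractible open set the path components of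
the preimage are then images of sections, the plaques, and openness in the leaf topology is read off
from the base. Hence a map over `M 0` between two such spaces restricts to coverings of leaves
(`IsUniqueFibration.isCoveringMap_leafMap`).

The covering attached to the core `C l` needs no universal cover. `GaloisClosure` consists of
families of points of `M l` indexed by the fibre over `x 0`, in the path component of the inclusion.
A loop fixes the inclusion under monodromy exactly if it acts trivially on the whole fibre, that is,
if it lies in `C l`. The quotient of Γ = π₁(M 0, x 0) by `C l` acts by reindexing, simply
transitively on the fibres over `M 0`. In the limit, `coreLimit` acts simply transitively on the
fibres over `M 0`, and the discriminant group is the subgroup whose orbits are the fibres over the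
solenoid (`CoveringTower.galoisLimitMap_eq_iff`).

Homogeneity follows by lifting isotopies of `M 0` and correcting within a fibre by `coreLimit`. The
bundle is principal because the action is free, the group is compact and local sections exist: a
section over one fibre comes from an open surjection of profinite sets, and lifting a contraction
extends it. Charts of the solenoid, pulled back through trivializations, make the total space a
matchbox manifold. -/

/-- A map that has the homotopy lifting property for all spaces (of the given universe) and unique
lifts of paths. -/
structure IsUniqueFibration {X B : Type u} [TopologicalSpace X] [TopologicalSpace B]
    (π : X → B) : Prop where
  continuous : Continuous π
  exists_lift : ∀ {A : Type u} [TopologicalSpace A] (H : C(I × A, B)) (f : C(A, X)),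
    (∀ a, H (0, a) = π (f a)) → ∃ H' : C(I × A, X), (∀ z, π (H' z) = H z) ∧ ∀ a, H' (0, a) = f a
  path_unique : ∀ γ γ' : C(I, X), (∀ t, π (γ t) = π (γ' t)) → γ 0 = γ' 0 → γ = γ'

/-- An open neighbourhood `N` of `b` that contracts to `b` within itself and relative to `b`. -/
structure IsContractibleNhd {B : Type u} [TopologicalSpace B] (b : B) (N : Set B) : Prop where
  isOpen : IsOpen N
  mem : b ∈ N
  exists_contraction : ∃ K : C(I × N, N), (∀ v, (K (0, v) : B) = b) ∧ (∀ v, K (1, v) = v) ∧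
    ∀ (t : I) (v : N), (v : B) = b → (K (t, v) : B) = b

section ContractibleNhd

variable {B : Type u} [TopologicalSpace B]

/-- A small ball in a chart is contracted to its centre along straight segments. -/
theorem exists_isContractibleNhd_of_chartedSpace {E : Type*} [NormedAddCommGroup E]
    [NormedSpace ℝ E] [ChartedSpace E B] (b : B) {W : Set B} (hW : W ∈ 𝓝 b) :
    ∃ N ⊆ W, IsContractibleNhd b N := by
  set φ := chartAt E b with hφ
  have hb : b ∈ φ.source := mem_chart_source E b
  obtain ⟨ε, hε, hεW⟩ : ∃ ε > 0, Metric.ball (φ b) ε ⊆ φ.target ∩ φ.symm ⁻¹' W := by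
    apply Metric.mem_nhds_iff.1
    apply Filter.inter_mem (φ.open_target.mem_nhds (φ.map_source hb))
    apply (φ.continuousAt_symm (φ.map_source hb)).preimage_mem_nhds
    rwa [φ.left_inv hb]
  set N : Set B := φ.source ∩ φ ⁻¹' Metric.ball (φ b) ε with hN
  have hline : ∀ (t : I) (v : N), φ b + (t : ℝ) • (φ v - φ b) ∈ Metric.ball (φ b) ε := by
    intro t v
    have hv : ‖φ v - φ b‖ < ε := by simpa [dist_eq_norm] using v.2.2
    rw [Metric.mem_ball, dist_eq_norm, add_sub_cancel_left, norm_smul, Real.norm_eq_abs,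
      abs_of_nonneg t.2.1]
    exact (mul_le_of_le_one_left (norm_nonneg _) t.2.2).trans_lt hv
  have hmem : ∀ (t : I) (v : N), φ.symm (φ b + (t : ℝ) • (φ v - φ b)) ∈ N := fun t v => by
    have h := hline t v
    exact ⟨φ.map_target (hεW h).1, by rw [mem_preimage, φ.right_inv (hεW h).1]; exact h⟩
  have hc : Continuous fun v : N => φ v :=
    continuousOn_iff_continuous_domRestrict.1 (φ.continuousOn.mono inter_subset_left)
  refine ⟨N, fun v hv => by simpa [φ.left_inv hv.1] using (hεW hv.2).2,
    φ.isOpen_inter_preimage Metric.isOpen_ball, ⟨hb, Metric.mem_ball_self hε⟩,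
    ⟨fun z : I × N => ⟨_, hmem z.1 z.2⟩, ?_⟩, ?_, ?_, ?_⟩
  · refine Continuous.subtype_mk (φ.continuousOn_symm.comp_continuous ?_
      fun z : I × N => (hεW (hline z.1 z.2)).1) _
    have := hc.comp (continuous_snd (X := I))
    have h1 : Continuous fun z : I × N => (z.1 : ℝ) := by fun_prop
    exact continuous_const.add (h1.smul (this.sub continuous_const))
  · intro v
    simp [φ.left_inv hb]
  · intro v
    ext
    simp [φ.left_inv v.2.1]
  · intro t v hv
    simp [hv, φ.left_inv hb]

end ContractibleNhd

namespace IsUniqueFibration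

variable {X Y B : Type u} [TopologicalSpace X] [TopologicalSpace Y] [TopologicalSpace B]
  {π : X → B} {πY : Y → B}

theorem path_unique_of_eq_one (h : IsUniqueFibration π) {γ γ' : C(I, X)}
    (hγ : ∀ t, π (γ t) = π (γ' t)) (h1 : γ 1 = γ' 1) : γ = γ' := by
  let s : C(I, I) := ⟨σ, unitInterval.continuous_symm⟩
  have := h.path_unique (γ.comp s) (γ'.comp s) (fun t => hγ _) (by simpa [s] using h1)
  ext t
  simpa [s] using DFunLike.congr_fun this (σ t)

theorem exists_path_lift (h : IsUniqueFibration π) (γ : C(I, B)) (x : X) (hx : γ 0 = π x) :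
    ∃ γ' : C(I, X), (∀ t, π (γ' t) = γ t) ∧ γ' 0 = x := by
  obtain ⟨H, hH, hH0⟩ := h.exists_lift (A := PUnit.{u + 1})
    (γ.comp ⟨Prod.fst, continuous_fst⟩) (.const _ x) (fun _ => hx)
  exact ⟨H.comp ⟨fun t => (t, PUnit.unit), by fun_prop⟩, fun t => hH _, hH0 _⟩

/-- The contraction of `N`, run outwards from `b`, is lifted with constant initial value `w`, where
`w` is reached from `x` by lifting the track of `π x` inwards; unique lifting makes the section pass
through `x`. Conversely, a path in the preimage of `N` from `x` has the same projection and start as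
its image under `S ∘ π`, so it stays in the range of `S`. -/
theorem exists_section (h : IsUniqueFibration π) {b : B} {N : Set B} (hN : IsContractibleNhd b N)
    (x : X) (hx : π x ∈ N) :
    ∃ S : C(N, X), (∀ v, π (S v) = v) ∧ S ⟨π x, hx⟩ = x ∧
      range S = pathComponentIn (π ⁻¹' N) x := by
  obtain ⟨K, K0, K1, Kb⟩ := hN.exists_contraction
  let ι : C(N, B) := ⟨Subtype.val, continuous_subtype_val⟩
  -- the lift of the reversed contraction path from `x` ends at `w` over `b`
  obtain ⟨β, hβ, hβ0⟩ := h.exists_path_lift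
    ⟨fun t => (K (σ t, ⟨π x, hx⟩) : B), by fun_prop⟩ x (by simp [K1])
  set w := β 1 with hw
  have hwb : π w = b := by simpa [K0] using hβ 1
  obtain ⟨H, hH, hH0⟩ := h.exists_lift (ι.comp K) (.const _ w) (fun a => by simp [ι, K0, hwb])
  let S : C(N, X) := H.comp ⟨fun v => (1, v), by fun_prop⟩
  have hS : ∀ v, π (S v) = v := fun v => by simp [S, hH, ι, K1]
  have hSx : S ⟨π x, hx⟩ = x := by
    have := h.path_unique_of_eq_one (γ := H.comp ⟨fun t => (σ t, ⟨π x, hx⟩), by fun_prop⟩)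
      (γ' := β) (fun t => by simp [hH, hβ, ι]) (by simp [hH0, hw])
    simpa [hβ0, S] using DFunLike.congr_fun this 0
  have hSb : S ⟨b, hN.mem⟩ = w := by
    have := h.path_unique (H.comp ⟨fun t => (t, ⟨b, hN.mem⟩), by fun_prop⟩)
      (.const _ w) (fun t => by simpa [hH, hwb, ι] using Kb t ⟨b, hN.mem⟩ rfl) (by simp [hH0])
    simpa [S] using DFunLike.congr_fun this 1
  have hwS : ∀ v, JoinedIn (π ⁻¹' N) w (S v) := fun v =>
    ⟨⟨H.comp ⟨fun t => (t, v), by fun_prop⟩, by simp [hH0], by simp [S]⟩,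
      fun t => by simp [hH, ι]⟩
  refine ⟨S, hS, hSx, ?_⟩
  ext z
  constructor
  · rintro ⟨v, rfl⟩
    have := hwS ⟨π x, hx⟩
    rw [hSx] at this
    exact this.symm.trans (hwS v)
  · intro hz
    have hzN : π z ∈ N := pathComponentIn_subset (F := π ⁻¹' N) hz
    obtain ⟨γ, hγ⟩ := hz
    have := h.path_unique (S.comp ⟨fun t => ⟨π (γ t), hγ t⟩,
      (h.continuous.comp γ.continuous).subtype_mk _⟩) γ.toContinuousMap (fun t => hS _)
      (by simpa using hSx)
    refine ⟨⟨π z, hzN⟩, ?_⟩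
    simpa using DFunLike.congr_fun this 1

theorem eq_of_mem_pathComponentIn (h : IsUniqueFibration π) {b : B} {N : Set B}
    (hN : IsContractibleNhd b N) {x y z : X} (hx : π x ∈ N)
    (hy : y ∈ pathComponentIn (π ⁻¹' N) x)
    (hz : z ∈ pathComponentIn (π ⁻¹' N) x) (hyz : π y = π z) : y = z := by
  obtain ⟨S, hS, -, hr⟩ := h.exists_section hN x hx
  rw [← hr] at hy hz
  obtain ⟨v, rfl⟩ := hy
  obtain ⟨v', rfl⟩ := hz
  rw [hS, hS] at hyz
  rw [Subtype.ext hyz]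

theorem exists_mem_pathComponentIn (h : IsUniqueFibration π) {b : B} {N : Set B}
    (hN : IsContractibleNhd b N) {x : X} (hx : π x ∈ N) {v : B} (hv : v ∈ N) :
    ∃ y ∈ pathComponentIn (π ⁻¹' N) x, π y = v := by
  obtain ⟨S, hS, -, hr⟩ := h.exists_section hN x hx
  exact ⟨S ⟨v, hv⟩, hr ▸ mem_range_self _, hS _⟩

end IsUniqueFibration

/-! ### The leaf topology of the total space of a fibration -/

theorem isOpen_leafTopology_pathComponentIn {X : Type u} [TopologicalSpace X] {U : Set X}
    (hU : IsOpen U) (x : X) : IsOpen[leafTopology X] (pathComponentIn U x) := by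
  by_cases hx : x ∈ U
  · exact .basic _ ⟨U, hU, x, hx, rfl⟩
  · rw [not_nonempty_iff_eq_empty.1 (mt pathComponentIn_nonempty_iff.1 hx)]
    exact @isOpen_empty _ (leafTopology X)

theorem mem_pathComponentIn_comm {X : Type u} [TopologicalSpace X] {U : Set X} {x y : X} :
    y ∈ pathComponentIn U x ↔ x ∈ pathComponentIn U y :=
  ⟨fun h => JoinedIn.symm h, fun h => JoinedIn.symm h⟩

section LeafTopology

variable {X Y B : Type u} [TopologicalSpace X] [TopologicalSpace Y] [TopologicalSpace B]
  {π : X → B} {πY : Y → B}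
  (hB : ∀ (b : B), ∀ W ∈ 𝓝 b, ∃ N ⊆ W, IsContractibleNhd b N)

include hB

/-- Only the generating sets need an argument. If `Z` is a path component of an open `O`, the
section through `x` maps a neighbourhood of `π x` into `O`; the plaque over a smaller contractible
neighbourhood is path connected and lies in `O`, hence in `Z`. -/
theorem IsUniqueFibration.exists_pathComponentIn_subset (h : IsUniqueFibration π) {Z : Set X}
    (hZ : IsOpen[leafTopology X] Z) {x : X} (hx : x ∈ Z) :
    ∃ N ∈ 𝓝 (π x), pathComponentIn (π ⁻¹' N) x ⊆ Z := by
  induction hZ generalizing x with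
  | basic s hs =>
    obtain ⟨O, hO, y, -, rfl⟩ := hs
    obtain ⟨N, -, hN⟩ := hB (π x) univ Filter.univ_mem
    obtain ⟨S, hS, hSx, hr⟩ := h.exists_section hN x hN.mem
    have hxO : x ∈ O := pathComponentIn_subset hx
    have hW : Subtype.val '' (S ⁻¹' O) ∈ 𝓝 (π x) :=
      (hN.isOpen.isOpenMap_subtype_val _ (hO.preimage S.continuous)).mem_nhds
        ⟨⟨π x, hN.mem⟩, by simpa [hSx] using hxO, rfl⟩
    obtain ⟨N', hN'W, hN'⟩ := hB (π x) _ hW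
    have hN'N : N' ⊆ N := fun v hv => by
      obtain ⟨v', -, rfl⟩ := hN'W hv
      exact v'.2
    refine ⟨N', hN'.isOpen.mem_nhds hN'.mem, ?_⟩
    rw [← pathComponentIn_congr hx]
    have hsub : pathComponentIn (π ⁻¹' N') x ⊆ O := fun z hz => by
      have hz' : z ∈ pathComponentIn (π ⁻¹' N) x := pathComponentIn_mono (preimage_mono hN'N) hz
      rw [← hr] at hz'
      obtain ⟨v, rfl⟩ := hz'
      have : π (S v) ∈ N' := pathComponentIn_subset (F := π ⁻¹' N') hz
      rw [hS] at this
      obtain ⟨v', hv', hvv'⟩ := hN'W this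
      rwa [Subtype.ext hvv'] at hv'
    have hxN' : x ∈ π ⁻¹' N' := hN'.mem
    exact (isPathConnected_pathComponentIn hxN').subset_pathComponentIn
      (mem_pathComponentIn_self hxN') hsub
  | univ => exact ⟨univ, Filter.univ_mem, subset_univ _⟩
  | inter s t _ _ ihs iht =>
    obtain ⟨N, hN, hNs⟩ := ihs hx.1
    obtain ⟨N', hN', hNt⟩ := iht hx.2
    exact ⟨N ∩ N', Filter.inter_mem hN hN', subset_inter
      ((pathComponentIn_mono (preimage_mono inter_subset_left)).trans hNs)
      ((pathComponentIn_mono (preimage_mono inter_subset_right)).trans hNt)⟩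
  | sUnion S _ ih =>
    obtain ⟨s, hs, hxs⟩ := hx
    obtain ⟨N, hN, hNs⟩ := ih s hs hxs
    exact ⟨N, hN, hNs.trans (subset_sUnion_of_mem hs)⟩

/-- A subset of a plaque is open in the leaf topology if and only if its projection is open. -/
theorem IsUniqueFibration.isOpen_leafTopology_iff (h : IsUniqueFibration π) {b : B} {N : Set B}
    (hN : IsContractibleNhd b N) {x : X} (hx : π x ∈ N) {Z : Set X}
    (hZ : Z ⊆ pathComponentIn (π ⁻¹' N) x) :
    IsOpen[leafTopology X] Z ↔ IsOpen (π '' Z) := by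
  constructor
  · intro hZo
    rw [isOpen_iff_mem_nhds]
    rintro _ ⟨z, hz, rfl⟩
    obtain ⟨M, hM, hMZ⟩ := h.exists_pathComponentIn_subset hB hZo hz
    obtain ⟨M', hM'M, hM'⟩ := hB _ M hM
    filter_upwards [hM'.isOpen.mem_nhds hM'.mem] with v hv
    obtain ⟨y, hy, rfl⟩ := h.exists_mem_pathComponentIn hM' hM'.mem hv
    exact ⟨y, hMZ (pathComponentIn_mono (preimage_mono hM'M) hy), rfl⟩
  · intro ho
    have hsub : π '' Z ⊆ N := by
      rintro _ ⟨z, hz, rfl⟩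
      exact pathComponentIn_subset (F := π ⁻¹' N) (hZ hz)
    -- `Z` is the union of the plaques over its own projection: a point of such a plaque has the
    -- same image as some point of `Z`, and both lie in one plaque over `N`, where `π` is injective.
    have : Z = ⋃ z ∈ Z, pathComponentIn (π ⁻¹' (π '' Z)) z := by
      ext y
      simp only [mem_iUnion, exists_prop]
      constructor
      · intro hy
        exact ⟨y, hy, mem_pathComponentIn_self ⟨y, hy, rfl⟩⟩
      · rintro ⟨z, hz, hy⟩
        obtain ⟨y', hy', hyy'⟩ := pathComponentIn_subset hy
        have h1 : y ∈ pathComponentIn (π ⁻¹' N) x := by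
          rw [← pathComponentIn_congr (hZ hz)]
          exact pathComponentIn_mono (preimage_mono hsub) hy
        rwa [← h.eq_of_mem_pathComponentIn hN hx (hZ hy') h1 hyy']
    rw [this]
    exact @isOpen_biUnion _ _ (leafTopology X) _ _ fun z _ =>
      isOpen_leafTopology_pathComponentIn (ho.preimage h.continuous) z

end LeafTopology

/-- A leaf is a path component of the open set `univ`, hence open in the leaf topology, and its
inclusion is an open embedding. -/
theorem isOpen_leaf_iff {X : Type u} [TopologicalSpace X] {x : X} {Z : Set (Leaf x)} :
    IsOpen Z ↔ IsOpen[leafTopology X] ((fun y : Leaf x => y.1) '' Z) := by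
  have hL : IsOpen[leafTopology X] (pathComponent x) := by
    rw [← pathComponentIn_univ]
    exact isOpen_leafTopology_pathComponentIn isOpen_univ x
  have he : @IsOpenEmbedding (Leaf x) X _ (leafTopology X) (fun y : Leaf x => y.1) :=
    @IsOpen.isOpenEmbedding_subtypeVal X (leafTopology X) _ hL
  exact @IsOpenEmbedding.isOpen_iff_image_isOpen _ _ _ _ (leafTopology X) he _

section LeafMap

variable {X Y B : Type u} [TopologicalSpace X] [TopologicalSpace Y] [TopologicalSpace B]
  {π : X → B} {πY : Y → B}
  (hB : ∀ (b : B), ∀ W ∈ 𝓝 b, ∃ N ⊆ W, IsContractibleNhd b N)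

/-- A path from `q x` in `Y` is projected to `B` and lifted to `X` from `x`; by unique lifting `q`
maps the lift back to the given path. -/
theorem IsUniqueFibration.surjective_leafMap (h : IsUniqueFibration π) (hY : IsUniqueFibration πY)
    (q : C(X, Y)) (hq : ∀ x, πY (q x) = π x) (x : X) : Function.Surjective (leafMap q x) := by
  rintro ⟨y, ⟨γ⟩⟩
  obtain ⟨γ', hγ', h0⟩ := h.exists_path_lift ((⟨πY, hY.continuous⟩ : C(Y, B)).comp γ) x
    (by simp [hq])
  have := hY.path_unique (q.comp γ') γ.toContinuousMap (fun t => by simp [hq, hγ']) (by simp [h0])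
  refine ⟨⟨γ' 1, ⟨⟨γ', h0, rfl⟩⟩⟩, Subtype.ext ?_⟩
  simpa [leafMap] using DFunLike.congr_fun this 1

include hB

/-- The evenly covered set is the plaque of `y` over a contractible `N`, and the sheets are the
plaques over `N` through the points of the fibre. All of these project bijectively to `N`, with
openness determined there, so `q` is a homeomorphism on each sheet. -/
theorem IsUniqueFibration.isCoveringMap_leafMap (h : IsUniqueFibration π)
    (hY : IsUniqueFibration πY) (q : C(X, Y)) (hq : ∀ x, πY (q x) = π x) (x : X) :
    IsCoveringMap (leafMap q x) := by
  classical
  intro y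
  obtain ⟨N, -, hN⟩ := hB (πY y.1) univ Filter.univ_mem
  have hqmap : ∀ {v w : X}, v ∈ pathComponentIn (π ⁻¹' N) w →
      q v ∈ pathComponentIn (πY ⁻¹' N) (q w) := fun {v w} hv => by
    obtain ⟨γ, hγ⟩ := hv
    exact ⟨γ.map q.continuous, fun t => by simpa [hq] using hγ t⟩
  let ι := {x' : Leaf x // leafMap q x x' = y}
  have hι : ∀ i : ι, q i.1.1 = y.1 := fun i => congrArg Subtype.val i.2
  have hιN : ∀ i : ι, π i.1.1 ∈ N := fun i => by
    rw [← hq, hι]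
    exact hN.mem
  have hπι : ∀ i : ι, π i.1.1 = πY y.1 := fun i => by rw [← hq, hι]
  let _ : TopologicalSpace ι := ⊥
  have : DiscreteTopology ι := ⟨rfl⟩
  have : Nonempty ι := by
    obtain ⟨x', hx'⟩ := h.surjective_leafMap hY q hq x y
    exact ⟨⟨x', hx'⟩⟩
  let V : Set (Leaf (q x)) := {y' | y'.1 ∈ pathComponentIn (πY ⁻¹' N) y.1}
  let U : ι → Set (Leaf x) := fun i => {x' | x'.1 ∈ pathComponentIn (π ⁻¹' N) i.1.1}
  have hV : (fun y' : Leaf (q x) => y'.1) '' V = pathComponentIn (πY ⁻¹' N) y.1 := by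
    ext z
    constructor
    · rintro ⟨z, hz, rfl⟩
      exact hz
    · intro hz
      exact ⟨⟨z, Joined.trans y.2 (JoinedIn.joined hz)⟩, hz, rfl⟩
  have inj : ∀ i, (U i).InjOn (leafMap q x) := fun i v hv w hw hvw => Subtype.ext <|
    h.eq_of_mem_pathComponentIn hN (hιN i) hv hw <| by
      rw [← hq, ← hq]
      exact congrArg (fun z : Leaf (q x) => πY z.1) hvw
  have surj : ∀ i, (U i).SurjOn (leafMap q x) V := fun i y' hy' => by
    obtain ⟨v, hv, hvy⟩ := h.exists_mem_pathComponentIn hN (hιN i)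
      (pathComponentIn_subset (F := πY ⁻¹' N) hy')
    refine ⟨⟨v, Joined.trans i.1.2 (JoinedIn.joined hv)⟩, hv, Subtype.ext ?_⟩
    have h1 := hqmap hv
    rw [hι] at h1
    exact hY.eq_of_mem_pathComponentIn hN hN.mem h1 hy' ((hq v).trans hvy)
  have open_V : IsOpen V := by
    rw [isOpen_leaf_iff, hV]
    exact isOpen_leafTopology_pathComponentIn (hN.isOpen.preimage hY.continuous) _
  have disjoint : Pairwise (Function.onFun Disjoint U) := fun i j hij => by
    rw [Function.onFun, Set.disjoint_left]
    intro v hvi hvj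
    refine hij (Subtype.ext (Subtype.ext ?_))
    refine h.eq_of_mem_pathComponentIn hN (hιN i) (mem_pathComponentIn_self (hιN i)) ?_
      ((hπι i).trans (hπι j).symm)
    have h1 : v.1 ∈ pathComponentIn (π ⁻¹' N) i.1.1 := hvi
    rw [← pathComponentIn_congr h1]
    exact mem_pathComponentIn_comm.1 hvj
  -- The plaque of `v` contains a point `w` over `πY y`. Its image lies in the plaque of `y` and
  -- over the same point as `y`, so `w` is in the fibre and indexes the sheet of `v`.
  have exhaustive : leafMap q x ⁻¹' V ⊆ ⋃ i, U i := fun v hv => by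
    have hv' : q v.1 ∈ pathComponentIn (πY ⁻¹' N) y.1 := hv
    have hvN : π v.1 ∈ N := by
      rw [← hq]
      exact pathComponentIn_subset (F := πY ⁻¹' N) hv'
    obtain ⟨w, hw, hwy⟩ := h.exists_mem_pathComponentIn hN hvN hN.mem
    have h1 := hqmap hw
    rw [pathComponentIn_congr hv'] at h1
    have h2 : q w = y.1 := hY.eq_of_mem_pathComponentIn hN hN.mem h1
      (mem_pathComponentIn_self hN.mem) (by rw [hq, hwy])
    exact mem_iUnion.2 ⟨⟨⟨w, Joined.trans v.2 (JoinedIn.joined hw)⟩, Subtype.ext h2⟩,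
      mem_pathComponentIn_comm.1 hw⟩
  -- Both sets lie in plaques over `N` and have the same image in `B`, which decides openness.
  have open_iff : ∀ i {W}, W ⊆ V → (IsOpen W ↔ IsOpen (leafMap q x ⁻¹' W ∩ U i)) := by
    intro i W hW
    rw [isOpen_leaf_iff, isOpen_leaf_iff, hY.isOpen_leafTopology_iff hB hN (x := y.1) hN.mem,
      h.isOpen_leafTopology_iff hB hN (hιN i)]
    · have : πY '' ((fun y : Leaf (q x) => y.1) '' W) =
          π '' ((fun y : Leaf x => y.1) '' (leafMap q x ⁻¹' W ∩ U i)) := by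
        ext b
        simp only [mem_image, exists_exists_and_eq_and]
        constructor
        · rintro ⟨w, hw, rfl⟩
          obtain ⟨v, hv, rfl⟩ := surj i (hW hw)
          exact ⟨v, ⟨hw, hv⟩, (hq _).symm⟩
        · rintro ⟨v, ⟨hv, -⟩, rfl⟩
          exact ⟨_, hv, hq _⟩
      rw [this]
    · rintro _ ⟨v, hv, rfl⟩
      exact hv.2
    · rintro _ ⟨v, hv, rfl⟩
      exact hW hv
  have : Nonempty (Leaf (q x) → Leaf x) :=
    ⟨fun _ => ⟨x, mem_pathComponent_self x⟩⟩
  exact (IsEvenlyCovered.of_trivialization (t := open_V.trivializationDiscrete U V open_iff inj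
    surj disjoint exhaustive) (mem_pathComponentIn_self hN.mem)).to_isEvenlyCovered_preimage

end LeafMap

/-! ### Homogeneity -/

section Bump

variable {E : Type*} [NormedAddCommGroup E]

/-- The conical bump function of radius `r` at `c`. -/
noncomputable def coneBump (c : E) (r : ℝ) (x : E) : ℝ :=
  max 0 (1 - ‖x - c‖ / r)

theorem continuous_coneBump (c : E) (r : ℝ) : Continuous (coneBump c r) := by
  unfold coneBump
  fun_prop

theorem coneBump_self (c : E) (r : ℝ) : coneBump c r c = 1 := by
  simp [coneBump]

theorem coneBump_nonneg (c : E) (r : ℝ) (x : E) : 0 ≤ coneBump c r x :=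
  le_max_left _ _

theorem coneBump_eq_zero {c : E} {r : ℝ} (hr : 0 < r) {x : E} (hx : r ≤ ‖x - c‖) :
    coneBump c r x = 0 :=
  max_eq_left (by rw [sub_nonpos, one_le_div hr]; exact hx)

theorem abs_coneBump_sub_le (c : E) {r : ℝ} (hr : 0 < r) (x y : E) :
    |coneBump c r x - coneBump c r y| ≤ ‖x - y‖ / r := by
  refine (abs_max_sub_max_le_max _ _ _ _).trans (max_le (by simp; positivity) ?_)
  rw [show 1 - ‖x - c‖ / r - (1 - ‖y - c‖ / r) = (‖y - c‖ - ‖x - c‖) / r by ring, abs_div,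
    abs_of_pos hr, norm_sub_rev x y]
  gcongr
  simpa using abs_norm_sub_norm_le (y - c) (x - c)

variable [NormedSpace ℝ E]

theorem norm_coneBump_smul_sub_le (c v : E) {r : ℝ} (hr : 0 < r) (x y : E) :
    ‖coneBump c r x • v - coneBump c r y • v‖ ≤ ‖v‖ / r * ‖x - y‖ := by
  rw [← sub_smul, norm_smul, Real.norm_eq_abs]
  calc _ ≤ ‖x - y‖ / r * ‖v‖ := by gcongr; exact abs_coneBump_sub_le c hr x y
    _ = _ := by ring

/-- The perturbation of the identity has Lipschitz constant `‖v‖ / r < 1`. This gives injectivity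
directly, and surjectivity through the fixed point of `x ↦ y - coneBump c r x • v`. -/
theorem bijective_add_coneBump_smul [CompleteSpace E] (c v : E) {r : ℝ} (hr : 0 < r)
    (hv : ‖v‖ < r) : Function.Bijective fun x => x + coneBump c r x • v := by
  have hk : ‖v‖ / r < 1 := (div_lt_one hr).2 hv
  constructor
  · intro x y hxy
    have h1 : x - y = -(coneBump c r x • v - coneBump c r y • v) := by
      have : x + coneBump c r x • v = y + coneBump c r y • v := hxy
      rw [neg_sub, sub_eq_sub_iff_add_eq_add, this, add_comm]
    have h2 := norm_coneBump_smul_sub_le c v hr x y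
    rw [← norm_neg, ← h1] at h2
    by_contra hne
    have h3 : 0 < ‖x - y‖ := norm_pos_iff.2 (sub_ne_zero.2 hne)
    nlinarith
  · intro y
    have hc : ContractingWith ⟨‖v‖ / r, by positivity⟩ fun x => y - coneBump c r x • v := by
      refine ⟨hk, LipschitzWith.of_dist_le_mul fun a b => ?_⟩
      rw [dist_eq_norm, dist_eq_norm, sub_sub_sub_cancel_left, norm_sub_rev a b]
      exact norm_coneBump_smul_sub_le c v hr b a
    refine ⟨hc.fixedPoint _, ?_⟩
    have h : y - coneBump c r (hc.fixedPoint _) • v = hc.fixedPoint _ :=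
      hc.fixedPoint_isFixedPt
    show hc.fixedPoint _ + coneBump c r (hc.fixedPoint _) • v = y
    nth_rw 1 [← h]
    abel

/-- The displacement is at most `coneBump c r x * r`, which inside the ball is exactly the distance
left to its boundary. -/
theorem norm_add_smul_coneBump_sub_le (c v : E) {r : ℝ} (hr : 0 < r) (hv : ‖v‖ < r) {x : E}
    (hx : ‖x - c‖ ≤ r) {t : ℝ} (h0 : 0 ≤ t) (h1 : t ≤ 1) :
    ‖x + t • coneBump c r x • v - c‖ ≤ r := by
  have h2 : coneBump c r x * r = r - ‖x - c‖ := by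
    rw [coneBump, max_eq_right (by rw [sub_nonneg, div_le_one hr]; exact hx)]
    field_simp
  have h3 := coneBump_nonneg c r x
  calc ‖x + t • coneBump c r x • v - c‖ = ‖(x - c) + t • coneBump c r x • v‖ := by congr 1; abel
    _ ≤ ‖x - c‖ + t * (coneBump c r x * ‖v‖) := by
      refine (norm_add_le _ _).trans ?_
      rw [norm_smul, norm_smul, Real.norm_of_nonneg h0, Real.norm_of_nonneg h3]
    _ ≤ ‖x - c‖ + 1 * (coneBump c r x * r) := by gcongr
    _ = r := by rw [h2]; ring

end Bump

/-! ### Isotopies of the base and their lifts -/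

section

variable {B : Type u} [TopologicalSpace B]

/-- In a chart the isotopy is translation by `v = φ b' - φ b`, damped by the cone bump: it moves the
centre by all of `v` and is the identity outside a closed ball, so it extends by the identity to
`B`. -/
theorem exists_homotopy_moving_of_chartedSpace {E : Type*} [NormedAddCommGroup E]
    [NormedSpace ℝ E] [ProperSpace E] [T2Space B] [ChartedSpace E B] (b : B) :
    ∃ N ∈ 𝓝 b, ∀ b' ∈ N, ∃ H : C(I × B, B), (∀ a, H (0, a) = a) ∧
      Function.Bijective (fun a => H (1, a)) ∧ H (1, b) = b' := by
  classical
  set φ := chartAt E b with hφ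
  have hb : b ∈ φ.source := mem_chart_source E b
  set c := φ b with hc
  obtain ⟨r, hr, hrt⟩ : ∃ r > 0, Metric.closedBall c r ⊆ φ.target :=
    Metric.nhds_basis_closedBall.mem_iff.1 (φ.open_target.mem_nhds (φ.map_source hb))
  refine ⟨φ.source ∩ φ ⁻¹' Metric.ball c r, (φ.isOpen_inter_preimage Metric.isOpen_ball).mem_nhds
    ⟨hb, Metric.mem_ball_self hr⟩, fun b' hb' => ?_⟩
  set v := φ b' - c with hv_def
  have hv : ‖v‖ < r := by simpa [dist_eq_norm] using hb'.2
  let g : ℝ → E → E := fun t x => x + t • coneBump c r x • v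
  have hg_out : ∀ t x, r ≤ ‖x - c‖ → g t x = x := fun t x hx => by
    simp [g, coneBump_eq_zero hr hx]
  have hg_in : ∀ (t : I) x, ‖x - c‖ ≤ r → ‖g t x - c‖ ≤ r := fun t x hx =>
    norm_add_smul_coneBump_sub_le c v hr hv hx t.2.1 t.2.2
  have hgt : ∀ (t : I) x, x ∈ φ.target → g t x ∈ φ.target := fun t x hx => by
    rcases le_total r ‖x - c‖ with h | h
    · rwa [hg_out t x h]
    · exact hrt (by simpa [dist_eq_norm] using hg_in t x h)
  let h : I × B → B := fun z =>
    if z.2 ∈ φ.source then φ.symm (g z.1 (φ z.2)) else z.2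
  have hhs : ∀ z : I × B, z.2 ∈ φ.source → h z = φ.symm (g z.1 (φ z.2)) := fun z hz => if_pos hz
  have hhn : ∀ z : I × B, z.2 ∉ φ.source → h z = z.2 := fun z hz => if_neg hz
  have hh_mem : ∀ z : I × B, z.2 ∈ φ.source → h z ∈ φ.source := fun z hz => by
    rw [hhs z hz]
    exact φ.map_target (hgt _ _ (φ.map_source hz))
  have hh_φ : ∀ z : I × B, z.2 ∈ φ.source → φ (h z) = g z.1 (φ z.2) := fun z hz => by
    rw [hhs z hz, φ.right_inv (hgt _ _ (φ.map_source hz))]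
  -- The support is compact, hence closed in the Hausdorff space `B`. So the points outside the
  -- chart have a neighbourhood on which `h` is the identity.
  set C : Set B := φ.symm '' Metric.closedBall c r with hC
  have hCclosed : IsClosed C :=
    ((isCompact_closedBall c r).image_of_continuousOn (φ.continuousOn_symm.mono hrt)).isClosed
  have hhC : ∀ z : I × B, z.2 ∉ C → h z = z.2 := fun z hz => by
    by_cases hs : z.2 ∈ φ.source
    · rw [hhs z hs, hg_out, φ.left_inv hs]
      by_contra hlt
      exact hz ⟨φ z.2, by simpa [dist_eq_norm] using (not_le.1 hlt).le, φ.left_inv hs⟩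
    · exact hhn z hs
  have hcont : Continuous h := by
    rw [continuous_iff_continuousAt]
    rintro ⟨t, a⟩
    by_cases ha : a ∈ φ.source
    · have hO : IsOpen {z : I × B | z.2 ∈ φ.source} := φ.open_source.preimage continuous_snd
      refine ContinuousOn.continuousAt (s := {z : I × B | z.2 ∈ φ.source}) ?_ (hO.mem_nhds ha)
      refine ContinuousOn.congr (f := fun z : I × B => φ.symm (g z.1 (φ z.2))) ?_
        fun z hz => hhs z hz
      refine φ.continuousOn_symm.comp ?_ fun z hz => hgt _ _ (φ.map_source hz)
      have h1 : ContinuousOn (fun z : I × B => φ z.2) {z : I × B | z.2 ∈ φ.source} :=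
        φ.continuousOn.comp continuous_snd.continuousOn fun z hz => hz
      have h2 : ContinuousOn (fun z : I × B => (z.1 : ℝ)) {z : I × B | z.2 ∈ φ.source} := by
        fun_prop
      exact h1.add (h2.smul (((continuous_coneBump c r).comp_continuousOn h1).smul
        continuousOn_const))
    · have haC : a ∉ C := by
        rintro ⟨x, hx, rfl⟩
        exact ha (φ.map_target (hrt hx))
      have hO : {z : I × B | z.2 ∈ Cᶜ} ∈ 𝓝 (t, a) :=
        (hCclosed.isOpen_compl.preimage continuous_snd).mem_nhds haC
      refine continuous_snd.continuousAt.congr ?_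
      filter_upwards [hO] with z hz
      exact (hhC z hz).symm
  have hbij := bijective_add_coneBump_smul c v hr hv
  have hg1 : ∀ x, g (1 : I) x = x + coneBump c r x • v := fun x => by simp [g]
  refine ⟨⟨h, hcont⟩, fun a => ?_, ⟨fun a a' haa' => ?_, fun a => ?_⟩, ?_⟩
  · by_cases ha : a ∈ φ.source
    · simp [hhs (0, a) ha, g, φ.left_inv ha]
    · exact hhn _ ha
  · have haa : h (1, a) = h (1, a') := haa'
    by_cases ha : a ∈ φ.source <;> by_cases ha' : a' ∈ φ.source
    · have h1 := congrArg φ haa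
      rw [hh_φ _ ha, hh_φ _ ha'] at h1
      simp only [hg1] at h1
      exact φ.injOn ha ha' (hbij.1 h1)
    · rw [hhn (1, a') ha'] at haa
      exact absurd (haa.subst (motive := (· ∈ φ.source)) (hh_mem (1, a) ha)) ha'
    · rw [hhn (1, a) ha] at haa
      exact absurd (haa.symm.subst (motive := (· ∈ φ.source)) (hh_mem (1, a') ha')) ha
    · rwa [hhn (1, a) ha, hhn (1, a') ha'] at haa
  · by_cases ha : a ∈ φ.source
    · obtain ⟨x, hx⟩ := hbij.2 (φ a)
      have hx' : g (1 : I) x = φ a := (hg1 x).trans hx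
      -- The preimage `x` exists in `E` only; it is in the image of the chart because either it lies
      -- in the ball or `g` does not move it.
      have hxt : x ∈ φ.target := by
        rcases le_total r ‖x - c‖ with hle | hle
        · rw [hg_out _ x hle] at hx'
          rw [hx']
          exact φ.map_source ha
        · exact hrt (by simpa [dist_eq_norm] using hle)
      refine ⟨φ.symm x, ?_⟩
      show h (1, φ.symm x) = a
      rw [hhs _ (φ.map_target hxt), φ.right_inv hxt]
      rw [hx', φ.left_inv ha]
    · exact ⟨a, hhn _ ha⟩
  · show h (1, b) = b'
    rw [hhs _ hb]
    rw [hg1, ← hc, coneBump_self, one_smul, hv_def, add_sub_cancel, φ.left_inv hb'.1]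

end

/-- The isotopy composed with `π` is lifted, starting at the identity of `X`. Two tracks with the
same end have the same projection, because the time-one map of the base is injective, so they agree
by unique lifting backwards. Lifting a reversed track from `y` yields a preimage of `y`. -/
theorem IsUniqueFibration.exists_homeomorph_lift {X B : Type u} [TopologicalSpace X]
    [TopologicalSpace B] [CompactSpace X] [T2Space X] {π : X → B} (h : IsUniqueFibration π)
    (H : C(I × B, B)) (H0 : ∀ a, H (0, a) = a) (H1 : Function.Bijective fun a => H (1, a)) :
    ∃ f : X ≃ₜ X, ∀ x, π (f x) = H (1, π x) := by
  obtain ⟨H', hH', h0⟩ := h.exists_lift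
    (H.comp ((ContinuousMap.id I).prodMap ⟨π, h.continuous⟩)) (.id X) (by simp [H0])
  have hH : ∀ t x, π (H' (t, x)) = H (t, π x) := fun t x => by simp [hH']
  have h0' : ∀ x, H' (0, x) = x := by simpa using h0
  let γ : X → C(I, X) := fun x => H'.comp ⟨fun t => (t, x), by fun_prop⟩
  have hbij : Function.Bijective fun x => H' (1, x) := by
    constructor
    · intro x y hxy
      have hxy' : H' (1, x) = H' (1, y) := hxy
      have hπ : π x = π y := H1.1 (by simp only [← hH, hxy'])
      have := h.path_unique_of_eq_one (γ := γ x) (γ' := γ y) (fun t => by simp [γ, hH, hπ]) hxy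
      simpa [γ, h0'] using DFunLike.congr_fun this 0
    · intro y
      obtain ⟨b, hb⟩ := H1.2 (π y)
      obtain ⟨β, hβ, hβ0⟩ := h.exists_path_lift (H.comp ⟨fun t => (σ t, b), by fun_prop⟩) y
        (by simpa using hb)
      have hβ1 : π (β 1) = b := by simp [hβ, H0]
      have := h.path_unique (γ (β 1)) (β.comp ⟨σ, unitInterval.continuous_symm⟩)
        (fun t => by simp [γ, hH, hβ1]; simp [hβ]) (by simp [γ, h0'])
      exact ⟨β 1, by simpa [γ, hβ0] using DFunLike.congr_fun this 1⟩
  have hc : Continuous (Equiv.ofBijective _ hbij) := by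
    show Continuous fun x => H' (1, x)
    fun_prop
  exact ⟨hc.homeoOfEquivCompactToT2, fun x => hH 1 x⟩

/-- The total space is homogeneous if the fibres are, and points of the base can locally be moved
by isotopies. -/
theorem IsUniqueFibration.isHomogeneousSpace {X B : Type u} [TopologicalSpace X]
    [TopologicalSpace B] [CompactSpace X] [T2Space X] [PreconnectedSpace X] {π : X → B}
    (h : IsUniqueFibration π)
    (hB : ∀ b : B, ∃ N ∈ 𝓝 b, ∀ b' ∈ N, ∃ H : C(I × B, B), (∀ a, H (0, a) = a) ∧
      Function.Bijective (fun a => H (1, a)) ∧ H (1, b) = b')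
    (hfib : ∀ x y, π x = π y → ∃ f : X ≃ₜ X, f x = y) : IsHomogeneousSpace X := by
  have hopen : ∀ x : X, IsOpen {y | ∃ f : X ≃ₜ X, f x = y} := fun x => by
    rw [isOpen_iff_mem_nhds]
    rintro _ ⟨f, rfl⟩
    obtain ⟨N, hN, hNH⟩ := hB (π (f x))
    filter_upwards [h.continuous.continuousAt.preimage_mem_nhds hN] with y hy
    obtain ⟨H, H0, H1, Hb⟩ := hNH _ hy
    obtain ⟨k, hk⟩ := h.exists_homeomorph_lift H H0 H1
    -- The lifted homeomorphism reaches only the fibre of `y`; homogeneity of that fibre does the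
    -- rest.
    obtain ⟨d, hd⟩ := hfib (k (f x)) y (by rw [hk, Hb])
    exact ⟨(f.trans k).trans d, hd⟩
  intro x y
  -- The complement of an orbit is a union of orbits, which are open; connectedness then leaves a
  -- single orbit.
  have hclosed : IsClosed {y | ∃ f : X ≃ₜ X, f x = y} := by
    rw [← isOpen_compl_iff, isOpen_iff_mem_nhds]
    intro y hy
    filter_upwards [(hopen y).mem_nhds ⟨Homeomorph.refl X, rfl⟩]
    rintro _ ⟨f, rfl⟩ ⟨k, hk⟩
    exact hy ⟨k.trans f.symm, by simp [hk]⟩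
  have := (IsClopen.eq_univ ⟨hclosed, hopen x⟩ ⟨x, Homeomorph.refl X, rfl⟩)
  exact this.ge (mem_univ y)

/-! ### Principal bundles -/

/-- An open surjection from a compact inverse limit of finite sets has a continuous section. -/
theorem exists_continuous_section_of_isOpenMap {F G : Type*} [TopologicalSpace F] [CompactSpace F]
    [TopologicalSpace G] [T2Space G] {A : ℕ → Type*} [∀ l, TopologicalSpace (A l)]
    [∀ l, DiscreteTopology (A l)] [∀ l, Finite (A l)] {q : F → G} (hq : Continuous q)
    (hqo : IsOpenMap q) (hqs : Function.Surjective q) (c : ∀ l, F → A l)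
    (hc : ∀ l, Continuous (c l)) (p : ∀ l, A (l + 1) → A l) (hp : ∀ l x, p l (c (l + 1) x) = c l x)
    (hinj : ∀ x y, (∀ l, c l x = c l y) → x = y) :
    ∃ s : C(G, F), ∀ y, q (s y) = y := by
  classical
  -- `J l y` is the set of `l`-th coordinates attained on the fibre over `y`. Since `q` is open and
  -- closed, this finite set varies locally constantly with `y`.
  let J : ∀ l, G → Set (A l) := fun l y => c l '' (q ⁻¹' {y})
  have hJmem : ∀ l a, IsClopen {y | a ∈ J l y} := fun l a => by
    have h1 : {y | a ∈ J l y} = q '' (c l ⁻¹' {a}) := by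
      ext y
      exact ⟨fun ⟨x, hx, hxa⟩ => ⟨x, hxa, hx⟩, fun ⟨x, hxa, hx⟩ => ⟨x, hx, hxa⟩⟩
    have h2 : IsClopen (c l ⁻¹' {a}) := (isClopen_discrete {a}).preimage (hc l)
    rw [h1]
    exact ⟨hq.isClosedMap _ h2.1, hqo _ h2.2⟩
  have hJ : ∀ l, IsLocallyConstant (J l) := fun l => by
    rw [IsLocallyConstant.iff_isOpen_fiber]
    intro T
    have : J l ⁻¹' {T} = ⋂ a, {y | a ∈ J l y ↔ a ∈ T} := by
      ext y
      simp [Set.ext_iff]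
    rw [this]
    refine isOpen_iInter_of_finite fun a => ?_
    by_cases ha : a ∈ T
    · simpa [ha] using (hJmem l a).2
    · simpa [ha, compl_ofPred] using (hJmem l a).1.isOpen_compl
  have hne : ∀ y, ∃ x, q x = y := hqs
  have hstep : ∀ l y (a : A l), a ∈ J l y → ∃ a' ∈ J (l + 1) y, p l a' = a := by
    rintro l y _ ⟨x, hx, rfl⟩
    exact ⟨_, ⟨x, hx, rfl⟩, hp l x⟩
  -- the coordinates of the section, chosen recursively
  let next : ∀ l, Set (A (l + 1)) → A l → Option (A (l + 1)) := fun l T a =>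
    if h : ∃ a' ∈ T, p l a' = a then some h.choose else none
  let s : ∀ l, G → Option (A l) := fun l => Nat.rec
    (fun y => if h : (J 0 y).Nonempty then some h.choose else none)
    (fun l sl y => (sl y).bind (next l (J (l + 1) y))) l
  have hs : ∀ l y, ∃ a ∈ J l y, s l y = some a := by
    intro l y
    induction l with
    | zero =>
      obtain ⟨x, hx⟩ := hne y
      have h : (J 0 y).Nonempty := ⟨_, x, hx, rfl⟩
      exact ⟨h.choose, h.choose_spec, dif_pos h⟩
    | succ l ih =>
      obtain ⟨a, ha, hsa⟩ := ih
      have h := hstep l y a ha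
      refine ⟨h.choose, h.choose_spec.1, ?_⟩
      show (s l y).bind (next l (J (l + 1) y)) = _
      rw [hsa]
      exact dif_pos h
  choose t ht hst using hs
  have htp : ∀ l y, p l (t (l + 1) y) = t l y := by
    intro l y
    have h := hstep l y _ (ht l y)
    have h1 : s (l + 1) y = some h.choose := by
      show (s l y).bind (next l (J (l + 1) y)) = _
      rw [hst]
      exact dif_pos h
    rw [Option.some.inj ((hst (l + 1) y).symm.trans h1)]
    exact h.choose_spec.2
  have hsc : ∀ l, IsLocallyConstant (s l) := by
    intro l
    induction l with
    | zero => exact (hJ 0).comp (fun T => if h : T.Nonempty then some h.choose else none)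
    | succ l ih =>
      exact ((hJ (l + 1)).prodMk ih).comp fun z => z.2.bind (next l z.1)
  have htc : ∀ l, Continuous (t l) := fun l => by
    have h1 : IsLocallyConstant (t l) := by
      refine (IsLocallyConstant.iff_exists_open _).2 fun y => ?_
      obtain ⟨U, hU, hy, hUs⟩ := (IsLocallyConstant.iff_exists_open _).1 (hsc l) y
      refine ⟨U, hU, hy, fun y' hy' => Option.some.inj ?_⟩
      rw [← hst, ← hst, hUs y' hy']
    exact h1.continuous
  have hex : ∀ y, ∃ x, q x = y ∧ ∀ l, c l x = t l y := by
    intro y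
    -- The sets of points of the fibre with the prescribed `l`-th coordinate are nonempty, compact
    -- and decreasing, so one point has all prescribed coordinates.
    let Z : ℕ → Set F := fun l => q ⁻¹' {y} ∩ c l ⁻¹' {t l y}
    have hZc : ∀ l, IsClosed (Z l) := fun l =>
      (isClosed_singleton.preimage hq).inter ((isClosed_discrete _).preimage (hc l))
    obtain ⟨x, hx⟩ := IsCompact.nonempty_iInter_of_sequence_nonempty_isCompact_isClosed Z
      (fun l x hx => ⟨hx.1, by
        have h1 : c (l + 1) x = t (l + 1) y := hx.2
        show c l x = t l y
        rw [← hp, h1, htp]⟩)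
      (fun l => by
        obtain ⟨x, hx, hxt⟩ := ht l y
        exact ⟨x, hx, hxt⟩)
      (hZc 0).isCompact hZc
    rw [mem_iInter] at hx
    exact ⟨x, (hx 0).1, fun l => (hx l).2⟩
  choose g hg hgt using hex
  have hemb : IsClosedEmbedding fun x l => c l x :=
    (continuous_pi hc).isClosedEmbedding fun x y hxy => hinj x y fun l => congrFun hxy l
  refine ⟨⟨g, hemb.isInducing.continuous_iff.2 (continuous_pi fun l => ?_)⟩, hg⟩
  exact (htc l).congr fun y => (hgt y l).symm

section Orbits

variable {D E B : Type*} [Group D] [MulAction D E] [TopologicalSpace E] [TopologicalSpace B]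

/-- The saturation of an open set is the union of its translates, hence open, and `q` is a quotient
map as a closed surjection. -/
theorem isOpenMap_of_fibres_eq_orbits [ContinuousConstSMul D E] [CompactSpace E] [T2Space B]
    {q : E → B} (hq : Continuous q) (hqs : Function.Surjective q)
    (horb : ∀ z z', q z = q z' ↔ ∃ d : D, d • z = z') : IsOpenMap q := by
  intro O hO
  rw [← (hq.isClosedMap.isQuotientMap hq hqs).isOpen_preimage]
  have : q ⁻¹' (q '' O) = ⋃ d : D, (fun z => d • z) ⁻¹' O := by
    ext z
    simp only [mem_preimage, mem_image, mem_iUnion]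
    constructor
    · rintro ⟨z', hz', h⟩
      obtain ⟨d, rfl⟩ := (horb z z').1 h.symm
      exact ⟨d, hz'⟩
    · rintro ⟨d, hd⟩
      exact ⟨_, hd, ((horb z _).2 ⟨d, rfl⟩).symm⟩
  rw [this]
  exact isOpen_iUnion fun d => hO.preimage (continuous_const_smul d)

end Orbits

/-- Over `V` each `z` is `δ z • s (q z)` for a unique `δ z`, which is the fibre coordinate of the
trivialization. Uniqueness also gives `δ (d • z) = d * δ z`. -/
theorem IsPrincipalBundle.of_local_sections {D E B : Type u} [Group D] [TopologicalSpace D]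
    [TopologicalSpace E] [TopologicalSpace B] [MulAction D E] [CompactSpace D] [T2Space E]
    [ContinuousSMul D E] {q : E → B} (hq : Continuous q)
    (horb : ∀ z z', q z = q z' ↔ ∃ d : D, d • z = z')
    (hfree : ∀ (d d' : D) (z : E), d • z = d' • z → d = d')
    (hsec : ∀ b : B, ∃ V : Set B, IsOpen V ∧ b ∈ V ∧ ∃ s : C(V, E), ∀ v, q (s v) = v) :
    IsPrincipalBundle D q := by
  classical
  have hsmul : ∀ (d : D) (z : E), q (d • z) = q z := fun d z => ((horb z _).2 ⟨d, rfl⟩).symm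
  refine ⟨‹_›, hsmul, fun b => ?_⟩
  obtain ⟨V, hV, hb, s, hs⟩ := hsec b
  have hex : ∀ z : q ⁻¹' V, ∃ d : D, d • s ⟨q z, z.2⟩ = z := fun z =>
    (horb _ _).1 (hs _)
  choose δ hδ using hex
  have hδ_unique : ∀ (z : q ⁻¹' V) (d : D), d • s ⟨q z, z.2⟩ = z → d = δ z := fun z d h =>
    hfree _ _ _ (h.trans (hδ z).symm)
  have hqV : Continuous fun z : q ⁻¹' V => s ⟨q z, z.2⟩ := by fun_prop
  have hδc : Continuous δ := by
    rw [continuous_iff_isClosed]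
    intro C hC
    -- Continuity of `δ` is a closed graph argument: the preimage of `C` is the projection of a
    -- closed set along the compact factor `D`.
    have hG : IsClosed {w : (q ⁻¹' V) × D | w.2 ∈ C ∧ w.2 • s ⟨q w.1, w.1.2⟩ = w.1} :=
      (hC.preimage continuous_snd).inter
        (isClosed_eq (continuous_snd.smul (hqV.comp continuous_fst)) (by fun_prop))
    have : δ ⁻¹' C = Prod.fst '' {w : (q ⁻¹' V) × D | w.2 ∈ C ∧ w.2 • s ⟨q w.1, w.1.2⟩ = w.1} := by
      ext z
      constructor
      · intro hz
        exact ⟨(z, δ z), ⟨hz, hδ z⟩, rfl⟩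
      · rintro ⟨⟨z, d⟩, ⟨hd, hdz⟩, rfl⟩
        rw [mem_preimage, ← hδ_unique z d hdz]
        exact hd
    rw [this]
    exact isClosedMap_fst_of_compactSpace _ hG
  let f : E → B × D := fun z => (q z, if h : q z ∈ V then δ ⟨z, h⟩ else 1)
  have hf : ∀ (z : E) (h : q z ∈ V), f z = (q z, δ ⟨z, h⟩) := fun z h => by simp [f, h]
  let k : B × D → E := fun w => if h : w.1 ∈ V then w.2 • s ⟨w.1, h⟩ else s ⟨b, hb⟩
  have hk : ∀ (w : B × D) (h : w.1 ∈ V), k w = w.2 • s ⟨w.1, h⟩ := fun w h => by simp [k, h]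
  have hqk : ∀ (w : B × D), w.1 ∈ V → q (k w) = w.1 := fun w h => by rw [hk w h, hsmul, hs]
  let e : Bundle.Trivialization D q :=
    { toFun := f
      invFun := k
      source := q ⁻¹' V
      target := V ×ˢ univ
      map_source' := fun z hz => ⟨hz, mem_univ _⟩
      map_target' := fun w hw => by
        rw [mem_preimage, hqk w hw.1]
        exact hw.1
      left_inv' := fun z hz => by
        rw [hf z hz, hk (q z, _) hz]
        exact hδ ⟨z, hz⟩
      right_inv' := fun w hw => by
        have h1 := hqk w hw.1
        have h2 : q (k w) ∈ V := h1.symm ▸ hw.1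
        rw [hf _ h2]
        refine Prod.ext h1 (hδ_unique ⟨k w, h2⟩ w.2 ?_).symm
        simp only [h1]
        exact (hk w hw.1).symm
      open_source := hV.preimage hq
      open_target := hV.prod isOpen_univ
      continuousOn_toFun := by
        rw [continuousOn_iff_continuous_domRestrict]
        refine ((hq.comp continuous_subtype_val).prodMk hδc).congr fun z => ?_
        exact (hf z z.2).symm
      continuousOn_invFun := by
        rw [continuousOn_iff_continuous_domRestrict]
        have h1 : Continuous fun w : (V ×ˢ univ : Set (B × D)) =>
            w.1.2 • s ⟨w.1.1, w.2.1⟩ := by fun_prop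
        exact h1.congr fun w => (hk w w.2.1).symm
      baseSet := V
      open_baseSet := hV
      source_eq := rfl
      target_eq := rfl
      proj_toFun := fun z _ => rfl }
  refine ⟨e, hb, fun d z hz => ?_⟩
  have h1 : q (d • z) ∈ V := (hsmul d z).symm ▸ hz
  show (f (d • z)).2 = d * (f z).2
  rw [hf z hz, hf _ h1]
  refine (hδ_unique ⟨d • z, h1⟩ (d * δ ⟨z, hz⟩) ?_).symm
  have h2 := hδ ⟨z, hz⟩
  simp only [hsmul, mul_smul] at h2 ⊢
  rw [h2]

/-- A section over one fibre extends to the preimage of a contractible neighbourhood. -/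
theorem IsUniqueFibration.exists_local_section {X Y B : Type u} [TopologicalSpace X]
    [TopologicalSpace Y] [TopologicalSpace B] {π : X → B} {πY : Y → B} (h : IsUniqueFibration π)
    (hY : IsUniqueFibration πY) (q : C(X, Y)) (hq : ∀ x, πY (q x) = π x) {b : B} {N : Set B}
    (hN : IsContractibleNhd b N) (s : C(πY ⁻¹' {b}, X)) (hs : ∀ y, q (s y) = y) :
    ∃ e : C(πY ⁻¹' N, X), ∀ y, q (e y) = y := by
  obtain ⟨K, K0, K1, -⟩ := hN.exists_contraction
  have hYc := hY.continuous
  let pr : C(πY ⁻¹' N, N) := ⟨fun y => ⟨πY y, y.2⟩, by fun_prop⟩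
  -- The lifted contraction pushes the preimage of `N` into the fibre over `b`. There `s` applies,
  -- and a lift of the opposite homotopy to `X` carries the result back.
  obtain ⟨H, hH, hH0⟩ := hY.exists_lift
    (⟨fun z => (K (σ z.1, pr z.2) : B), by fun_prop⟩ : C(I × (πY ⁻¹' N), B))
    ⟨Subtype.val, continuous_subtype_val⟩ (by simp [K1, pr])
  let ρ : C(πY ⁻¹' N, πY ⁻¹' {b}) := ⟨fun y => ⟨H (1, y), by simp [hH, K0]⟩, by fun_prop⟩
  obtain ⟨H', hH', hH'0⟩ := h.exists_lift
    (⟨fun z => (K (z.1, pr z.2) : B), by fun_prop⟩ : C(I × (πY ⁻¹' N), B))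
    (s.comp ρ) (fun y => by
      have h1 : πY (ρ y) = b := (ρ y).2
      rw [ContinuousMap.comp_apply, ← hq, hs, h1]
      exact K0 _)
  refine ⟨H'.comp ⟨fun y => (1, y), by fun_prop⟩, fun y => ?_⟩
  -- The image in `Y` of the way back and the reversed way in lift the same path and start at the
  -- same point `ρ y`, so they end at the same point, namely `y`.
  have := hY.path_unique (q.comp (H'.comp ⟨fun t => (t, y), by fun_prop⟩))
    (H.comp ⟨fun t => (σ t, y), by fun_prop⟩) (fun t => by simp [hq, hH', hH])
    (by simp [hH'0, hs, ρ])
  simpa [hH0] using DFunLike.congr_fun this 1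

/-! ### Matchbox structures on bundles with totally disconnected fibre -/

section Rescaling

variable {E F : Type*} [NormedAddCommGroup E] [NormedSpace ℝ E] [NormedAddCommGroup F]
  [NormedSpace ℝ F]

/-- The right side depends continuously on the derivative of `f` at the rescaled point, through a
fixed continuous linear map. This carries continuity in the transverse parameter over to rescaled
charts. -/
theorem iteratedFDeriv_comp_rescaling (f : E → F) (a : E) (a' : F) (ρ : ℝˣ) (k : ℝ) (j : ℕ)
    (x : E) (hf : ContDiffAt ℝ ∞ f (a + (ρ : ℝ) • x)) :
    iteratedFDeriv ℝ j (fun v => k • (f (a + (ρ : ℝ) • v) - a')) x =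
      k • (ContinuousMultilinearMap.compContinuousLinearMapL
        (fun _ => (ContinuousLinearEquiv.smulLeft ρ : E ≃L[ℝ] E).toContinuousLinearMap)
          (iteratedFDeriv ℝ j f (a + (ρ : ℝ) • x)) -
        iteratedFDeriv ℝ j (fun _ : E => a') x) := by
  have hj : (j : WithTop ℕ∞) ≤ ∞ := by exact_mod_cast le_top
  have h1 : ContDiffAt ℝ j (fun v => f (a + (ρ : ℝ) • v)) x :=
    (hf.of_le hj).comp x (by fun_prop)
  have h2 : ContDiffAt ℝ j (fun _ : E => a') x := contDiffAt_const
  have h3 : (fun v => k • (f (a + (ρ : ℝ) • v) - a')) =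
      k • ((fun v => f (a + (ρ : ℝ) • v)) - fun _ => a') := rfl
  have h5 : ContDiffAt ℝ j ((fun v => f (a + (ρ : ℝ) • v)) - fun _ => a') x := h1.sub h2
  rw [h3, iteratedFDeriv_const_smul_apply h5, iteratedFDeriv_sub_apply h1 h2]
  congr 2
  have h4 := (ContinuousLinearEquiv.smulLeft ρ : E ≃L[ℝ] E).iteratedFDerivWithin_comp_right
    (fun v => f (a + v)) uniqueDiffOn_univ (x := x) (mem_univ _) j
  rw [preimage_univ, iteratedFDerivWithin_univ, iteratedFDerivWithin_univ,
    iteratedFDeriv_comp_add_left] at h4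
  exact h4

end Rescaling

namespace FoliationChart

variable {n : ℕ} {X Y : Type u} [TopologicalSpace X] [TopologicalSpace Y]

/-- The transversal injects continuously into `Y` as the slice over `0`. Being compact Hausdorff and
totally disconnected, it then has small clopen neighbourhoods. -/
theorem t2Space [T2Space Y] (c : FoliationChart n Y) : T2Space c.T := by
  have h : ∀ t : c.T, ((0 : EuclideanSpace ℝ (Fin n)), t) ∈ c.chart.target := fun t => by
    rw [c.target_eq]
    exact ⟨fun i => by simp, mem_univ _⟩
  refine T2Space.of_injective_continuous (f := fun t : c.T => c.chart.symm (0, t)) ?_ ?_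
  · intro t t' htt'
    exact congrArg Prod.snd (c.chart.symm.injOn (h t) (h t') htt')
  · exact c.chart.continuousOn_symm.comp_continuous (by fun_prop) h

/-- The plaques of the chart `c'` are mapped to the plaques of the chart `c` by rescalings. -/
def IsPullback (q : X → Y) (c' : FoliationChart n X) (c : FoliationChart n Y) : Prop :=
  ∃ (a : EuclideanSpace ℝ (Fin n)) (ρ : ℝˣ) (τ : c'.T → c.T), Continuous τ ∧
    ∀ z ∈ c'.chart.target, (a + (ρ : ℝ) • z.1, τ z.2) ∈ c.chart.target ∧
      q (c'.chart.symm z) = c.chart.symm (a + (ρ : ℝ) • z.1, τ z.2)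

theorem isOpen_overlap (c c' : FoliationChart n X) : IsOpen (c.overlap c') :=
  (c.chart.symm.trans c'.chart).open_source

theorem mem_overlap_iff {c c' : FoliationChart n X} {z : EuclideanSpace ℝ (Fin n) × c.T} :
    z ∈ c.overlap c' ↔ z ∈ c.chart.target ∧ c.chart.symm z ∈ c'.chart.source := by
  simp [overlap]

/-- The leaf component of the transition upstairs is that downstairs, composed with affine
rescalings in the leaf variable and with the continuous `τ₁` in the transverse one. -/
theorem SmoothTransition.of_isPullback {q : X → Y} {c₁' c₂' : FoliationChart n X}
    {c₁ c₂ : FoliationChart n Y} (h₁ : IsPullback q c₁' c₁) (h₂ : IsPullback q c₂' c₂)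
    (h : c₁.SmoothTransition c₂) : c₁'.SmoothTransition c₂' := by
  obtain ⟨a₁, ρ₁, τ₁, hτ₁, hφ₁⟩ := h₁
  obtain ⟨a₂, ρ₂, τ₂, -, hφ₂⟩ := h₂
  have key : ∀ z ∈ c₁'.overlap c₂', (a₁ + (ρ₁ : ℝ) • z.1, τ₁ z.2) ∈ c₁.overlap c₂ ∧
      c₁'.leafTransition c₂' z =
        (ρ₂ : ℝ)⁻¹ • (c₁.leafTransition c₂ (a₁ + (ρ₁ : ℝ) • z.1, τ₁ z.2) - a₂) := by
    intro z hz
    rw [mem_overlap_iff] at hz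
    obtain ⟨hz1, hq1⟩ := hφ₁ z hz.1
    set w := c₂'.chart (c₁'.chart.symm z) with hw
    have hwt : w ∈ c₂'.chart.target := c₂'.chart.map_source hz.2
    obtain ⟨hw1, hq2⟩ := hφ₂ w hwt
    have hx : c₂'.chart.symm w = c₁'.chart.symm z := c₂'.chart.left_inv hz.2
    rw [hx, hq1] at hq2
    refine ⟨mem_overlap_iff.2 ⟨hz1, hq2 ▸ c₂.chart.map_target hw1⟩, ?_⟩
    have : c₁.leafTransition c₂ (a₁ + (ρ₁ : ℝ) • z.1, τ₁ z.2) = a₂ + (ρ₂ : ℝ) • w.1 := by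
      rw [leafTransition, hq2, c₂.chart.right_inv hw1]
    rw [this, add_sub_cancel_left, inv_smul_smul₀ ρ₂.ne_zero]
    rfl
  have hslice : ∀ t, IsOpen {v | (v, t) ∈ c₁.overlap c₂} := fun t =>
    (c₁.isOpen_overlap c₂).preimage (Continuous.prodMk_left t)
  have hslice' : ∀ t, IsOpen {v | (v, t) ∈ c₁'.overlap c₂'} := fun t =>
    (c₁'.isOpen_overlap c₂').preimage (Continuous.prodMk_left t)
  refine ⟨fun t => ?_, fun k => ?_⟩
  · have h1 : ContDiffOn ℝ ∞ (fun v : EuclideanSpace ℝ (Fin n) =>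
        (ρ₂ : ℝ)⁻¹ • (c₁.leafTransition c₂ (a₁ + (ρ₁ : ℝ) • v, τ₁ t) - a₂))
        {v | (v, t) ∈ c₁'.overlap c₂'} := by
      refine ContDiffOn.const_smul _ (ContDiffOn.sub ?_ contDiffOn_const)
      refine (h.contDiffOn (τ₁ t)).comp (g := fun v => c₁.leafTransition c₂ (v, τ₁ t))
        (f := fun v => a₁ + (ρ₁ : ℝ) • v) (by fun_prop) ?_
      exact fun v hv => (key (v, t) hv).1
    exact h1.congr fun v hv => (key (v, t) hv).2
  · have hcont : Continuous fun z : EuclideanSpace ℝ (Fin n) × c₁'.T =>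
        (a₁ + (ρ₁ : ℝ) • z.1, τ₁ z.2) := by fun_prop
    have h1 : ContinuousOn (fun z : EuclideanSpace ℝ (Fin n) × c₁'.T =>
        iteratedFDeriv ℝ k (fun v => c₁.leafTransition c₂ (v, τ₁ z.2)) (a₁ + (ρ₁ : ℝ) • z.1))
        (c₁'.overlap c₂') :=
      (h.continuousOn k).comp hcont.continuousOn fun z hz => (key z hz).1
    have h2 : Continuous fun v : EuclideanSpace ℝ (Fin n) =>
        iteratedFDeriv ℝ k (fun _ : EuclideanSpace ℝ (Fin n) => a₂) v :=
      (contDiff_const (n := (k : WithTop ℕ∞))).continuous_iteratedFDeriv le_rfl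
    let L := ContinuousMultilinearMap.compContinuousLinearMapL (𝕜 := ℝ)
      (F := EuclideanSpace ℝ (Fin n)) fun _ : Fin k => (ContinuousLinearEquiv.smulLeft ρ₁ :
      EuclideanSpace ℝ (Fin n) ≃L[ℝ] EuclideanSpace ℝ (Fin n)).toContinuousLinearMap
    refine ContinuousOn.congr (((L.continuous.comp_continuousOn h1).sub
      (h2.comp continuous_fst).continuousOn).const_smul (ρ₂ : ℝ)⁻¹) fun z hz => ?_
    refine Eq.trans ?_ (iteratedFDeriv_comp_rescaling
      (fun v => c₁.leafTransition c₂ (v, τ₁ z.2)) a₁ a₂ ρ₁ (ρ₂ : ℝ)⁻¹ k z.1 ?_)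
    -- The formula for the transition holds only on the overlap; its slices are open, so the germs
    -- and hence the derivatives agree.
    · refine Filter.EventuallyEq.eq_of_nhds (Filter.EventuallyEq.iteratedFDeriv ℝ ?_ k)
      filter_upwards [(hslice' z.2).mem_nhds (show z.1 ∈ {v | (v, z.2) ∈ _} from hz)] with v hv
      exact (key (v, z.2) hv).2
    · exact (h.contDiffOn _).contDiffAt ((hslice (τ₁ z.2)).mem_nhds (key z hz).1)

/-- A small box around `q x`, with clopen transversal `T'`, lies in the chart and over the base set
of `e`; its preimage is the box times `D`. The new transversal is `T' × D`. -/
theorem exists_isPullback {D : Type u} [TopologicalSpace D] [CompactSpace D]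
    [TotallyDisconnectedSpace D] [T2Space Y] {q : X → Y} (c : FoliationChart n Y)
    (e : Bundle.Trivialization D q) {x : X} (hc : q x ∈ c.chart.source) (he : q x ∈ e.baseSet) :
    ∃ c' : FoliationChart n X, x ∈ c'.chart.source ∧ IsPullback q c' c := by
  have := c.t2Space
  set p := c.chart (q x) with hp
  set cube : Set (EuclideanSpace ℝ (Fin n)) := {v | ∀ i, v i ∈ Ioo (-1 : ℝ) 1} with hcube
  have hcube_open : IsOpen cube := by
    rw [hcube, ofPred_forall]
    exact isOpen_iInter_of_finite fun i => isOpen_Ioo.preimage (by fun_prop)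
  have hcube_norm : ∀ v ∈ cube, ‖v‖ ≤ Real.sqrt n := fun v hv => by
    rw [EuclideanSpace.norm_eq]
    refine Real.sqrt_le_sqrt ?_
    calc ∑ i, ‖v i‖ ^ 2 ≤ ∑ _i : Fin n, (1 : ℝ) := Finset.sum_le_sum fun i _ => by
          rw [Real.norm_eq_abs, sq_abs, sq_le_one_iff_abs_le_one]
          exact abs_le.2 ⟨(hv i).1.le, (hv i).2.le⟩
      _ = n := by simp
  have hW : c.chart.target ∩ c.chart.symm ⁻¹' e.baseSet ∈ 𝓝 p :=
    (c.chart.isOpen_inter_preimage_symm e.open_baseSet).mem_nhds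
      ⟨c.chart.map_source hc, by rwa [mem_preimage, hp, c.chart.left_inv hc]⟩
  rw [← Prod.mk.eta (p := p), nhds_prod_eq, Filter.mem_prod_iff] at hW
  obtain ⟨U, hU, V, hV, hUV⟩ := hW
  obtain ⟨V', hV'V, hV'o, hpV'⟩ := mem_nhds_iff.1 hV
  obtain ⟨T', hT', hpT', hT'V⟩ := compact_exists_isClopen_in_isOpen hV'o hpV'
  obtain ⟨ε, hε, hεU⟩ := Metric.mem_nhds_iff.1 hU
  -- The cube has Euclidean norm at most `√n`, so this factor scales it into the `ε`-ball; the
  -- summand `1` makes the inequality strict and covers `n = 0`.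
  have hr : 0 < ε / (Real.sqrt n + 1) := by positivity
  let ρ : ℝˣ := Units.mk0 _ hr.ne'
  have hρ : (ρ : ℝ) = ε / (Real.sqrt n + 1) := rfl
  have hbox : ∀ v ∈ cube, ∀ t ∈ T', (p.1 + (ρ : ℝ) • v, t) ∈ c.chart.target ∧
      c.chart.symm (p.1 + (ρ : ℝ) • v, t) ∈ e.baseSet := fun v hv t ht => by
    refine hUV ⟨hεU ?_, hV'V (hT'V ht)⟩
    rw [Metric.mem_ball, dist_eq_norm, add_sub_cancel_left, norm_smul, Real.norm_eq_abs, hρ,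
      abs_of_pos hr, div_mul_eq_mul_div, div_lt_iff₀ (by positivity)]
    have := hcube_norm v hv
    gcongr
    linarith
  have : CompactSpace T' := isCompact_iff_compactSpace.1 hT'.1.isCompact
  let A : EuclideanSpace ℝ (Fin n) ≃ₜ EuclideanSpace ℝ (Fin n) :=
    (Homeomorph.smulOfNeZero (ρ : ℝ) ρ.ne_zero).trans (Homeomorph.addLeft p.1)
  have hA : ∀ v, A v = p.1 + (ρ : ℝ) • v := fun v => rfl
  let ψ : EuclideanSpace ℝ (Fin n) × (T' × D) → (EuclideanSpace ℝ (Fin n) × c.T) × D :=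
    fun z => ((A z.1, z.2.1), z.2.2)
  have hψ : IsOpenEmbedding ψ :=
    (Homeomorph.prodAssoc _ _ _).symm.isOpenEmbedding.comp
      (A.isOpenEmbedding.prodMap (hT'.2.isOpenEmbedding_subtypeVal.prodMap .id))
  have : Nonempty (EuclideanSpace ℝ (Fin n) × (T' × D)) := ⟨(0, (⟨p.2, hpT'⟩, (e x).2))⟩
  let F : OpenPartialHomeomorph (EuclideanSpace ℝ (Fin n) × (T' × D)) X :=
    ((hψ.toOpenPartialHomeomorph ψ).restrOpen (cube ×ˢ univ) (hcube_open.prod isOpen_univ)).trans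
      ((c.chart.prod (OpenPartialHomeomorph.refl D)).symm.trans e.toOpenPartialHomeomorph.symm)
  have hF : ∀ z, F z = e.toOpenPartialHomeomorph.symm
      (c.chart.symm (p.1 + (ρ : ℝ) • z.1, z.2.1), z.2.2) := fun z => rfl
  have hFs : F.source = cube ×ˢ univ := by
    ext z
    constructor
    · intro hz
      exact hz.1.2
    · intro hz
      obtain ⟨h1, h2⟩ := hbox z.1 hz.1 z.2.1 z.2.1.2
      refine ⟨⟨mem_univ _, hz⟩, ⟨h1, mem_univ _⟩, ?_⟩
      show _ ∈ e.target
      rw [e.target_eq]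
      exact ⟨h2, mem_univ _⟩
  let c' : FoliationChart n X := { T := T' × D, chart := F.symm, target_eq := hFs }
  refine ⟨c', ?_, p.1, ρ, fun t : T' × D => (t.1 : c.T),
    continuous_subtype_val.comp continuous_fst, fun z hz => ?_⟩
  · have h0 : (0, (⟨p.2, hpT'⟩, (e x).2)) ∈ F.source := by
      rw [hFs]
      exact ⟨fun i => by simp, mem_univ _⟩
    have h1 : F (0, (⟨p.2, hpT'⟩, (e x).2)) = x := by
      rw [hF]
      simp only [smul_zero, add_zero, Prod.mk.eta]
      rw [hp, c.chart.left_inv hc]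
      exact e.symm_apply_mk_proj (e.mem_source.2 he)
    have h2 := F.map_source h0
    rwa [h1] at h2
  · have hz' : z ∈ cube ×ˢ univ := hFs ▸ hz
    obtain ⟨h1, h2⟩ := hbox z.1 hz'.1 z.2.1 z.2.1.2
    refine ⟨h1, ?_⟩
    show q (F z) = _
    rw [hF]
    exact e.proj_symm_apply (e.mem_target.2 h2)

end FoliationChart

/-- The total space of a bundle with compact totally disconnected fibre over a matchbox manifold is
a matchbox manifold if it is compact, connected and metrizable. -/
theorem IsMatchboxManifold.of_trivialization {n : ℕ} {X Y D : Type u} [TopologicalSpace X]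
    [TopologicalSpace Y] [TopologicalSpace D] [CompactSpace D] [TotallyDisconnectedSpace D]
    (hY : IsMatchboxManifold n Y) (hX : CompactSpace X) (hX' : ConnectedSpace X)
    (hX'' : TopologicalSpace.MetrizableSpace X) (q : X → Y)
    (hq : ∀ y, ∃ e : Bundle.Trivialization D q, y ∈ e.baseSet) : IsMatchboxManifold n X := by
  have := hY.metrizableSpace
  obtain ⟨A, hA, hAs⟩ := hY.exists_atlas
  refine ⟨hX, hX', hX'', {c' | ∃ c ∈ A, FoliationChart.IsPullback q c' c}, fun x => ?_, ?_⟩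
  · obtain ⟨c, hc, hxc⟩ := hA (q x)
    obtain ⟨e, he⟩ := hq (q x)
    obtain ⟨c', hxc', hcc'⟩ := c.exists_isPullback e hxc he
    exact ⟨c', ⟨c, hc, hcc'⟩, hxc'⟩
  · rintro c₁' ⟨c₁, hc₁, h₁⟩ c₂' ⟨c₂, hc₂, h₂⟩
    exact .of_isPullback h₁ h₂ (hAs c₁ hc₁ c₂ hc₂)

/-! ### Monodromy -/

namespace IsCoveringMap

variable {E E' B : Type*} [TopologicalSpace E] [TopologicalSpace E'] [TopologicalSpace B]
  {π : E → B} {π' : E' → B}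

/-- Monodromy is natural for maps over the base. -/
theorem map_monodromy (cov : IsCoveringMap π) (cov' : IsCoveringMap π') (p : C(E', E))
    (hp : ∀ e, π (p e) = π' e) {x y : B} (γ : Path.Homotopic.Quotient x y) (e' : π' ⁻¹' {x})
    (e : π ⁻¹' {x}) (he : p e' = e) : p (cov'.monodromy γ e') = cov.monodromy γ e := by
  obtain ⟨γ⟩ := γ
  let Γ : C(I, E') := cov'.liftPath γ e' (γ.source.trans e'.2.symm)
  have h : p.comp Γ = cov.liftPath γ e (γ.source.trans e.2.symm) := by
    refine (cov.eq_liftPath_iff' _).2 ⟨?_, ?_⟩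
    · ext t
      simp only [Function.comp_apply, ContinuousMap.comp_apply, hp]
      exact congrFun (cov'.liftPath_lifts _ _ (γ.source.trans e'.2.symm)) t
    · simp [Γ, cov'.liftPath_zero, he]
  exact DFunLike.congr_fun h 1

theorem exists_monodromy_eq [PathConnectedSpace E] (cov : IsCoveringMap π) {x y : B}
    (e : π ⁻¹' {x}) (e' : π ⁻¹' {y}) :
    ∃ γ : Path.Homotopic.Quotient x y, cov.monodromy γ e = e' := by
  obtain ⟨e, rfl⟩ := e
  obtain ⟨e', rfl⟩ := e'
  exact ⟨_, cov.monodromy_map (.mk (PathConnectedSpace.somePath e e'))⟩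

/-- The image of the fundamental group consists of the loops whose lift from `e` closes up. -/
theorem mem_range_mapOfEq_iff (cov : IsCoveringMap π) {f : C(E, B)} (hf : ∀ e, f e = π e) {b : B}
    {e : E} (hfe : f e = b) (he : e ∈ π ⁻¹' {b}) (g : FundamentalGroup B b) :
    g ∈ (FundamentalGroup.mapOfEq f hfe).range ↔ cov.monodromy g ⟨e, he⟩ = ⟨e, he⟩ := by
  obtain rfl : f = ⟨π, cov.continuous⟩ := ContinuousMap.ext hf
  subst hfe
  constructor
  · rintro ⟨γ, rfl⟩
    rw [FundamentalGroup.mapOfEq_apply]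
    show cov.monodromy (Path.Homotopic.Quotient.cast _ rfl rfl) _ = _
    rw [Path.Homotopic.Quotient.cast_rfl_rfl]
    exact cov.monodromy_map γ
  · intro h
    refine ⟨(cov.liftPathQuotient g ⟨e, he⟩).cast rfl congr($h.symm), ?_⟩
    rw [FundamentalGroup.mapOfEq_apply,
      Path.Homotopic.Quotient.map_cast, IsCoveringMap.map_liftPathQuotient]
    exact (Path.Homotopic.Quotient.cast_cast _ _ _ _ _).trans
      ((Path.Homotopic.Quotient.cast_cast _ _ _ _ _).trans
        (Path.Homotopic.Quotient.cast_rfl_rfl _))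

/-- The core of the subgroup of a connected covering is the kernel of the monodromy action. -/
theorem normalCore_range_mapOfEq [PathConnectedSpace E] (cov : IsCoveringMap π) {f : C(E, B)}
    (hf : ∀ e, f e = π e) {b : B} {e : E} (hfe : f e = b) :
    (FundamentalGroup.mapOfEq f hfe).range.normalCore = (cov.monodromyPerm b).ker := by
  have he : e ∈ π ⁻¹' {b} := (hf e).symm.trans hfe
  ext g
  -- A conjugate of `g` lies in the subgroup exactly if `g` fixes a translate of `e`; as `E` is path
  -- connected, the translates fill the fibre.
  have h1 : ∀ k : FundamentalGroup B b, k * g * k⁻¹ ∈ (FundamentalGroup.mapOfEq f hfe).range ↔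
      cov.monodromyPerm b g ((cov.monodromyPerm b k)⁻¹ ⟨e, he⟩) =
        (cov.monodromyPerm b k)⁻¹ ⟨e, he⟩ := by
    intro k
    rw [cov.mem_range_mapOfEq_iff hf hfe he, ← cov.coe_monodromyPerm, map_mul, map_mul, map_inv,
      Equiv.Perm.mul_apply, Equiv.Perm.mul_apply, Equiv.Perm.eq_inv_iff_eq]
  rw [MonoidHom.mem_ker]
  constructor
  · intro hg
    ext1 a
    obtain ⟨k, hk⟩ := cov.exists_monodromy_eq ⟨e, he⟩ a
    have h2 := (h1 (k : FundamentalGroup B b)⁻¹).1 (hg _)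
    rw [map_inv, inv_inv, cov.coe_monodromyPerm (γ := k), hk] at h2
    exact h2
  · intro hg k
    rw [h1, hg]
    rfl

end IsCoveringMap

/-! ### The Galois closure of a covering -/

section FibreTuple

variable {M B : Type u} [TopologicalSpace M] [TopologicalSpace B]

/-- The families of points of `M`, indexed by the fibre of `π` over `b`, that lie over a common
point. -/
def FibreTuple (π : C(M, B)) (b : B) : Type u :=
  {f : ↥(π ⁻¹' {b}) → M // ∀ a a', π (f a) = π (f a')}

instance (π : C(M, B)) (b : B) : TopologicalSpace (FibreTuple π b) :=
  inferInstanceAs (TopologicalSpace {f : ↥(π ⁻¹' {b}) → M // ∀ a a', π (f a) = π (f a')})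

namespace FibreTuple

variable {π : C(M, B)} {b : B}

instance [T2Space M] : T2Space (FibreTuple π b) :=
  inferInstanceAs (T2Space {f : ↥(π ⁻¹' {b}) → M // ∀ a a', π (f a) = π (f a')})

theorem compactSpace [CompactSpace M] [T2Space B] : CompactSpace (FibreTuple π b) := by
  refine isCompact_iff_compactSpace.1 (IsClosed.isCompact
    (s := {f : ↥(π ⁻¹' {b}) → M | ∀ a a', π (f a) = π (f a')}) ?_)
  simp only [ofPred_forall]
  exact isClosed_iInter fun a => isClosed_iInter fun a' => isClosed_eq (by fun_prop) (by fun_prop)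

theorem continuous_eval (a : ↥(π ⁻¹' {b})) : Continuous fun f : FibreTuple π b => f.1 a :=
  (continuous_apply a).comp continuous_subtype_val

/-- The local inverses of `π` at the finitely many entries of a tuple are used simultaneously, on
the intersection of their domains. -/
theorem isLocalHomeomorph [Finite ↥(π ⁻¹' {b})] (hπ : IsLocalHomeomorph π)
    (a : ↥(π ⁻¹' {b})) :
    IsLocalHomeomorph fun f : FibreTuple π b => π (f.1 a) := by
  classical
  refine IsLocalHomeomorph.mk _ fun f => ?_
  choose φ hφ hφπ using fun a' => hπ (f.1 a')
  have hφπ' : ∀ a' m, φ a' m = π m := fun a' m => by rw [hφπ a']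
  let U : Set B := ⋂ a', (φ a').target
  have hsymm : ∀ a', ∀ v ∈ U, π ((φ a').symm v) = v := fun a' v hv => by
    rw [← hφπ' a', (φ a').right_inv (mem_iInter.1 hv a')]
  have hmem : ∀ g : FibreTuple π b, (∀ a', g.1 a' ∈ (φ a').source) → π (g.1 a) ∈ U := fun g hg =>
    mem_iInter.2 fun a' => by
      rw [g.2 a a', ← hφπ' a']
      exact (φ a').map_source (hg a')
  let k : B → FibreTuple π b := fun v =>
    if h : v ∈ U then ⟨fun a' => (φ a').symm v, fun a' a'' => by rw [hsymm _ v h, hsymm _ v h]⟩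
    else f
  have hk : ∀ v ∈ U, ∀ a', (k v).1 a' = (φ a').symm v := fun v hv a' => by simp [k, hv]
  refine ⟨{
    toFun := fun g => π (g.1 a)
    invFun := k
    source := {g | ∀ a', g.1 a' ∈ (φ a').source}
    target := U
    map_source' := hmem
    map_target' := fun v hv a' => by
      rw [hk v hv]
      exact (φ a').map_target (mem_iInter.1 hv a')
    left_inv' := fun g hg => by
      refine Subtype.ext (funext fun a' => ?_)
      rw [hk _ (hmem g hg), g.2 a a', ← hφπ' a', (φ a').left_inv (hg a')]
    right_inv' := fun v hv => by
      rw [hk v hv]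
      exact hsymm a v hv
    open_source := by
      rw [ofPred_forall]
      exact isOpen_iInter_of_finite fun a' => (φ a').open_source.preimage (continuous_eval a')
    open_target := isOpen_iInter_of_finite fun a' => (φ a').open_target
    continuousOn_toFun := (π.continuous.comp (continuous_eval a)).continuousOn
    continuousOn_invFun := by
      refine IsInducing.subtypeVal.continuousOn_iff.2 (continuousOn_pi.2 fun a' => ?_)
      exact ((φ a').continuousOn_symm.mono (iInter_subset _ a')).congr fun v hv => hk v hv a' },
    hφ, fun g _ => rfl⟩

variable (π b) in
/-- The inclusion of the fibre. -/
def inclusion : FibreTuple π b :=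
  ⟨Subtype.val, fun a a' => a.2.trans a'.2.symm⟩

end FibreTuple

/-- The space of a local homeomorphism into a charted space is a charted space. -/
@[reducible]
noncomputable def IsLocalHomeomorph.chartedSpaceOfBase {H X Y : Type*} [TopologicalSpace H]
    [TopologicalSpace X]
    [TopologicalSpace Y] [ChartedSpace H Y] {f : X → Y} (hf : IsLocalHomeomorph f) :
    ChartedSpace H X where
  atlas := range fun x => (hf x).choose.trans (chartAt H (f x))
  chartAt x := (hf x).choose.trans (chartAt H (f x))
  mem_chart_source x := by
    have h := (hf x).choose_spec
    rw [OpenPartialHomeomorph.trans_source]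
    refine ⟨h.1, ?_⟩
    rw [mem_preimage, ← h.2]
    exact mem_chart_source H (f x)
  chart_mem_atlas x := mem_range_self x

/-- The path component of the inclusion in the space of fibre tuples: the total space of the
Galois closure of the covering `π`. -/
def GaloisClosure (π : C(M, B)) (b : B) : Type u :=
  {f : FibreTuple π b // f ∈ pathComponent (FibreTuple.inclusion π b)}

instance (π : C(M, B)) (b : B) : TopologicalSpace (GaloisClosure π b) :=
  inferInstanceAs (TopologicalSpace {f // f ∈ pathComponent (FibreTuple.inclusion π b)})

namespace GaloisClosure

variable {π : C(M, B)} {b : B}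

@[ext]
theorem ext {f f' : GaloisClosure π b} (h : ∀ a, f.1.1 a = f'.1.1 a) : f = f' :=
  Subtype.ext (Subtype.ext (funext h))

/-- The evaluation at a point of the fibre. -/
def eval (a : ↥(π ⁻¹' {b})) : C(GaloisClosure π b, M) :=
  ⟨fun f => f.1.1 a, (FibreTuple.continuous_eval a).comp continuous_subtype_val⟩

theorem proj_eval (a a' : ↥(π ⁻¹' {b})) (f : GaloisClosure π b) :
    π (eval a f) = π (eval a' f) :=
  f.1.2 a a'

variable (π b) in
/-- The base point: the inclusion of the fibre. -/
def base : GaloisClosure π b :=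
  ⟨FibreTuple.inclusion π b, mem_pathComponent_self _⟩

theorem continuous_iff {A : Type*} [TopologicalSpace A] {f : A → GaloisClosure π b} :
    Continuous f ↔ ∀ a, Continuous fun x => eval a (f x) := by
  refine ⟨fun h a => (eval a).continuous.comp h, fun h => ?_⟩
  exact (((continuous_pi h).subtype_mk _).subtype_mk _)

instance [T2Space M] : T2Space (GaloisClosure π b) :=
  inferInstanceAs (T2Space {f // f ∈ pathComponent (FibreTuple.inclusion π b)})

instance : PathConnectedSpace (GaloisClosure π b) :=
  isPathConnected_iff_pathConnectedSpace.1 isPathConnected_pathComponent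

section Manifold

/-- The space of tuples is locally homeomorphic to `B`, hence locally path connected. -/
theorem isClopen_pathComponent (H : Type*) [TopologicalSpace H] [ChartedSpace H B]
    [LocallyPathConnectedSpace H] [Finite ↥(π ⁻¹' {b})] (hπ : IsLocalHomeomorph π)
    (a : ↥(π ⁻¹' {b})) :
    IsClopen (pathComponent (FibreTuple.inclusion π b)) := by
  let _ := (FibreTuple.isLocalHomeomorph hπ a).chartedSpaceOfBase (H := H)
  have := ChartedSpace.locallyPathConnectedSpace H (FibreTuple π b)
  exact ⟨IsClosed.pathComponent _, IsOpen.pathComponent _⟩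

theorem compactSpace (H : Type*) [TopologicalSpace H] [ChartedSpace H B]
    [LocallyPathConnectedSpace H] [Finite ↥(π ⁻¹' {b})] [CompactSpace M] [T2Space B]
    (hπ : IsLocalHomeomorph π)
    (a : ↥(π ⁻¹' {b})) : CompactSpace (GaloisClosure π b) := by
  have := FibreTuple.compactSpace (π := π) (b := b)
  exact isCompact_iff_compactSpace.1 (isClopen_pathComponent H hπ a).1.isCompact

theorem isLocalHomeomorph (H : Type*) [TopologicalSpace H] [ChartedSpace H B]
    [LocallyPathConnectedSpace H] [Finite ↥(π ⁻¹' {b})] (hπ : IsLocalHomeomorph π)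
    (a : ↥(π ⁻¹' {b})) :
    IsLocalHomeomorph (π.comp (eval a)) :=
  (FibreTuple.isLocalHomeomorph hπ a).comp
    (isClopen_pathComponent H hπ a).2.isOpenEmbedding_subtypeVal.isLocalHomeomorph

end Manifold

section Monodromy

/-- The point of the Galois closure determined by a path in the base. -/
noncomputable def ofPath (cov : IsCoveringMap π) {m : B} (α : Path.Homotopic.Quotient b m) :
    GaloisClosure π b :=
  ⟨⟨fun a => cov.monodromy α a, fun a a' =>
    (cov.monodromy α a).2.trans (cov.monodromy α a').2.symm⟩, by
    obtain ⟨γ⟩ := α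
    have h : ∀ a : ↥(π ⁻¹' {b}), γ 0 = π (a : M) := fun a => γ.source.trans a.2.symm
    have hl : ∀ (a : ↥(π ⁻¹' {b})) t, π (cov.liftPath γ a (h a) t) = γ t := fun a t =>
      congrFun (cov.liftPath_lifts γ a (h a)) t
    -- The lifts of `γ` from all points of the fibre together form a path of tuples starting at the
    -- inclusion.
    refine ⟨⟨⟨fun t => ⟨fun a => cov.liftPath γ a (h a) t, fun a a' => by rw [hl, hl]⟩, ?_⟩,
      ?_, ?_⟩⟩
    · exact (continuous_pi fun a : ↥(π ⁻¹' {b}) =>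
        (cov.liftPath γ (a : M) (h a)).continuous).subtype_mk _
    · exact Subtype.ext (funext fun a : ↥(π ⁻¹' {b}) => cov.liftPath_zero γ (a : M) (h a))
    · rfl⟩

/-- A path of tuples from the inclusion has a common projection to `B`, and each entry is the lift
of it from its own index. Questions about the Galois closure thus become questions about monodromy.
-/
theorem exists_eq_ofPath (cov : IsCoveringMap π) (f : GaloisClosure π b) (a : ↥(π ⁻¹' {b})) {m : B}
    (hm : π (eval a f) = m) : ∃ α : Path.Homotopic.Quotient b m, f = ofPath cov α := by
  obtain ⟨f, ⟨Γ⟩⟩ := f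
  subst hm
  let γ : Path b (π (f.1 a)) := ⟨⟨fun t => π ((Γ t).1 a),
    π.continuous.comp ((FibreTuple.continuous_eval a).comp Γ.continuous)⟩, by
    show π ((Γ 0).1 a) = b
    rw [Γ.source]
    exact a.2, by
    show π ((Γ 1).1 a) = _
    rw [Γ.target]⟩
  refine ⟨.mk γ, ?_⟩
  ext a'
  let Γ' : C(I, M) := ⟨fun t => (Γ t).1 a', 
    (FibreTuple.continuous_eval a').comp Γ.continuous⟩
  have h : Γ' = cov.liftPath γ a' (γ.source.trans a'.2.symm) := by
    refine (cov.eq_liftPath_iff' _).2 ⟨funext fun t => (Γ t).2 a' a, ?_⟩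
    show (Γ 0).1 a' = a'
    rw [Γ.source]
    rfl
  have h1 : (Γ 1).1 a' = _ := DFunLike.congr_fun h 1
  rwa [Γ.target] at h1

theorem injective_eval (cov : IsCoveringMap π) (f : GaloisClosure π b) :
    Function.Injective fun a => eval a f := by
  intro a a' haa'
  obtain ⟨m, hm⟩ : ∃ m, π (eval a f) = m := ⟨_, rfl⟩
  obtain ⟨α, rfl⟩ := exists_eq_ofPath cov f a hm
  exact (cov.monodromy_bijective α).1 (Subtype.ext haa')

/-- The action of the monodromy group on the Galois closure by reindexing. -/
noncomputable def reindex (cov : IsCoveringMap π) (s : (cov.monodromyPerm b).range)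
    (f : GaloisClosure π b) : GaloisClosure π b :=
  ⟨⟨fun a => f.1.1 (s.1⁻¹ a), fun a a' => f.1.2 _ _⟩, by
    obtain ⟨s, hs⟩ := s
    obtain ⟨g, hg⟩ := inv_mem hs
    by_cases hne : Nonempty ↥(π ⁻¹' {b})
    · obtain ⟨a⟩ := hne
      obtain ⟨m, hm⟩ : ∃ m, π (eval a f) = m := ⟨_, rfl⟩
      obtain ⟨α, rfl⟩ := exists_eq_ofPath cov f a hm
      -- Precomposing the monodromy of `α` with that of the loop `g` gives the monodromy of `g`
      -- followed by `α`, so reindexing stays in the path component.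
      refine (congrArg (· ∈ pathComponent (FibreTuple.inclusion π b)) ?_).mpr
        (ofPath cov (.trans g α)).2
      refine Subtype.ext (funext fun a' => ?_)
      simp only [← hg]
      exact congrArg (fun e : ↥(π ⁻¹' {m}) => (e : M)) (cov.monodromy_trans_apply g α a').symm
    · rw [not_nonempty_iff] at hne
      refine (congrArg (· ∈ pathComponent (FibreTuple.inclusion π b)) ?_).mpr
        (mem_pathComponent_self _)
      exact Subtype.ext (funext fun a => hne.elim a)⟩

theorem eval_reindex (cov : IsCoveringMap π) (s : (cov.monodromyPerm b).range)
    (f : GaloisClosure π b) (a : ↥(π ⁻¹' {b})) : eval a (reindex cov s f) = eval (s.1⁻¹ a) f :=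
  rfl

theorem reindex_one (cov : IsCoveringMap π) (f : GaloisClosure π b) : reindex cov 1 f = f :=
  rfl

theorem reindex_mul (cov : IsCoveringMap π) (s t : (cov.monodromyPerm b).range)
    (f : GaloisClosure π b) : reindex cov (s * t) f = reindex cov s (reindex cov t f) := by
  ext a
  show eval a (reindex cov (s * t) f) = eval a (reindex cov s (reindex cov t f))
  simp [eval_reindex]

theorem continuous_reindex (cov : IsCoveringMap π) (s : (cov.monodromyPerm b).range) :
    Continuous (reindex cov s) :=
  continuous_iff.2 fun a => (eval (s.1⁻¹ a)).continuous

theorem reindex_left_injective (cov : IsCoveringMap π) {s t : (cov.monodromyPerm b).range}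
    {f : GaloisClosure π b} (h : reindex cov s f = reindex cov t f) : s = t := by
  have h1 : s.1⁻¹ = t.1⁻¹ := by
    ext1 a
    exact injective_eval cov f (congrArg (eval a) h)
  exact Subtype.ext (inv_injective h1)

/-- The Galois closure is a regular covering. -/
theorem exists_reindex_eq (cov : IsCoveringMap π) (a : ↥(π ⁻¹' {b})) {f f' : GaloisClosure π b}
    (h : π (eval a f) = π (eval a f')) : ∃ s, reindex cov s f = f' := by
  obtain ⟨m, hm⟩ : ∃ m, π (eval a f) = m := ⟨_, rfl⟩
  obtain ⟨α, rfl⟩ := exists_eq_ofPath cov f a hm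
  obtain ⟨α', rfl⟩ := exists_eq_ofPath cov f' a (h.symm.trans hm)
  -- The loop runs along `α'` and back along `α`; followed by `α` it is homotopic to `α'`.
  let g : FundamentalGroup B b := Path.Homotopic.Quotient.trans α' α.symm
  refine ⟨⟨cov.monodromyPerm b g⁻¹, _, rfl⟩, ?_⟩
  ext a'
  show ((cov.monodromy α ((cov.monodromyPerm b g⁻¹)⁻¹ a') : ↥(π ⁻¹' {m})) : M) =
    cov.monodromy α' a'
  rw [map_inv, inv_inv, cov.coe_monodromyPerm]
  show ((cov.monodromy α (cov.monodromy (Path.Homotopic.Quotient.trans α' α.symm) a') :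
    ↥(π ⁻¹' {m})) : M) = _
  rw [← cov.monodromy_trans_apply, Path.Homotopic.Quotient.trans_assoc,
    Path.Homotopic.Quotient.symm_trans, Path.Homotopic.Quotient.trans_refl]

/-- The subgroup of the Galois closure is the kernel of the monodromy action. -/
theorem range_mapOfEq (cov : IsCoveringMap π) (a : ↥(π ⁻¹' {b}))
    (cov' : IsCoveringMap (π.comp (eval a))) {f : C(GaloisClosure π b, B)}
    (hf : ∀ e, f e = π (eval a e)) (h : f (base π b) = b) :
    (FundamentalGroup.mapOfEq f h).range = (cov.monodromyPerm b).ker := by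
  ext g
  have hb : base π b ∈ (π.comp (eval a)) ⁻¹' {b} := a.2
  -- Monodromy of the base point is the tuple of all monodromies in the fibre, so it is trivial
  -- exactly for `g` in the kernel.
  have key : ∀ a' : ↥(π ⁻¹' {b}), eval a' (cov'.monodromy g ⟨base π b, hb⟩ : GaloisClosure π b) =
      cov.monodromy g a' := fun a' =>
    cov.map_monodromy cov' (eval a') (fun e => proj_eval a' a e) g ⟨base π b, hb⟩ a' rfl
  rw [cov'.mem_range_mapOfEq_iff hf h hb, MonoidHom.mem_ker]
  constructor
  · intro hg
    ext1 a'
    refine Subtype.ext ?_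
    rw [cov.coe_monodromyPerm, ← key a', hg]
    rfl
  · intro hg
    refine Subtype.ext (ext fun a' => (key a').trans ?_)
    rw [← cov.coe_monodromyPerm, hg]
    rfl

end Monodromy

section Map

variable {M' : Type u} [TopologicalSpace M'] {π' : C(M', B)}

/-- The map induced on the fibres by a map over the base. -/
def fibreMap (p : C(M', M)) (hp : ∀ y, π (p y) = π' y) (a : ↥(π' ⁻¹' {b})) : ↥(π ⁻¹' {b}) :=
  ⟨p a, (hp a).trans a.2⟩

theorem surjective_fibreMap {p : C(M', M)} (hp : ∀ y, π (p y) = π' y)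
    (hs : Function.Surjective p) : Function.Surjective (fibreMap (b := b) p hp) := by
  rintro ⟨a, ha⟩
  obtain ⟨a', rfl⟩ := hs a
  exact ⟨⟨a', (hp a').symm.trans ha⟩, rfl⟩

/-- The map of Galois closures induced by a map over the base. -/
noncomputable def map (cov : IsCoveringMap π) (cov' : IsCoveringMap π') (p : C(M', M))
    (hp : ∀ y, π (p y) = π' y) (hs : Function.Surjective p) (a₀ : ↥(π' ⁻¹' {b})) :
    C(GaloisClosure π' b, GaloisClosure π b) :=
  -- Families are contravariant in the index set, so a section of the map of fibres is needed;
  -- `eval_map` shows that its choice does not matter.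
  let sec := Function.surjInv (surjective_fibreMap (b := b) hp hs)
  have hsec : ∀ a, fibreMap p hp (sec a) = a := Function.surjInv_eq _
  ⟨fun f => ⟨⟨fun a => p (eval (sec a) f), fun a a' => by
      rw [hp, hp]
      exact proj_eval _ _ f⟩, by
      obtain ⟨m, hm⟩ : ∃ m, π' (eval a₀ f) = m := ⟨_, rfl⟩
      obtain ⟨α, rfl⟩ := exists_eq_ofPath cov' f a₀ hm
      refine (congrArg (· ∈ pathComponent (FibreTuple.inclusion π b)) ?_).mpr (ofPath cov α).2
      exact Subtype.ext (funext fun a =>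
        cov.map_monodromy cov' p hp α (sec a) a (congrArg Subtype.val (hsec a)))⟩,
    continuous_iff.2 fun a => p.continuous.comp (eval (sec a)).continuous⟩

/-- By naturality of monodromy both sides depend only on the image of `a` in the fibre of `π`. -/
theorem eval_map (cov : IsCoveringMap π) (cov' : IsCoveringMap π') (p : C(M', M))
    (hp : ∀ y, π (p y) = π' y) (hs : Function.Surjective p) (a₀ : ↥(π' ⁻¹' {b}))
    (f : GaloisClosure π' b) (a : ↥(π' ⁻¹' {b})) :
    eval (fibreMap p hp a) (map cov cov' p hp hs a₀ f) = p (eval a f) := by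
  obtain ⟨m, hm⟩ : ∃ m, π' (eval a₀ f) = m := ⟨_, rfl⟩
  obtain ⟨α, rfl⟩ := exists_eq_ofPath cov' f a₀ hm
  show p (cov'.monodromy α (Function.surjInv (surjective_fibreMap hp hs) (fibreMap p hp a))) =
    p (cov'.monodromy α a)
  rw [cov.map_monodromy cov' p hp α _ (fibreMap p hp a)
    (congrArg Subtype.val (Function.surjInv_eq (surjective_fibreMap hp hs) _)),
    cov.map_monodromy cov' p hp α a (fibreMap p hp a) rfl]

theorem map_base (cov : IsCoveringMap π) (cov' : IsCoveringMap π') (p : C(M', M))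
    (hp : ∀ y, π (p y) = π' y) (hs : Function.Surjective p) (a₀ : ↥(π' ⁻¹' {b})) :
    map cov cov' p hp hs a₀ (base π' b) = base π b := by
  ext a
  obtain ⟨a, rfl⟩ := surjective_fibreMap hp hs a
  exact eval_map cov cov' p hp hs a₀ _ a

theorem map_reindex (cov : IsCoveringMap π) (cov' : IsCoveringMap π') (p : C(M', M))
    (hp : ∀ y, π (p y) = π' y) (hs : Function.Surjective p) (a₀ : ↥(π' ⁻¹' {b}))
    (f : GaloisClosure π' b) (g : FundamentalGroup B b) :
    map cov cov' p hp hs a₀ (reindex cov' ⟨cov'.monodromyPerm b g, g, rfl⟩ f) =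
      reindex cov ⟨cov.monodromyPerm b g, g, rfl⟩ (map cov cov' p hp hs a₀ f) := by
  ext a
  obtain ⟨a, rfl⟩ := surjective_fibreMap hp hs a
  refine (eval_map cov cov' p hp hs a₀ _ a).trans ?_
  rw [eval_reindex, ← eval_map cov cov' p hp hs a₀]
  refine congrArg (fun a => eval a (map cov cov' p hp hs a₀ f)) (Subtype.ext ?_)
  simp only [← map_inv]
  exact cov.map_monodromy cov' p hp (g⁻¹ : FundamentalGroup B b) a (fibreMap p hp a) rfl

end Map

end GaloisClosure

end FibreTuple

/-! ### Fibrations from coverings and towers -/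

section

variable {X Y B : Type u} [TopologicalSpace X] [TopologicalSpace Y] [TopologicalSpace B]

theorem IsCoveringMap.isUniqueFibration {π : X → B} (cov : IsCoveringMap π) :
    IsUniqueFibration π where
  continuous := cov.continuous
  exists_lift H f h0 := ⟨cov.liftHomotopy H f h0, congrFun (cov.liftHomotopy_lifts H f h0),
    cov.liftHomotopy_zero H f h0⟩
  path_unique γ γ' h h0 := DFunLike.ext' <|
    cov.eq_of_comp_eq γ.continuous γ'.continuous (funext h) 0 h0

theorem IsUniqueFibration.comp {π : Y → B} {q : X → Y} (hπ : IsUniqueFibration π)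
    (hq : IsUniqueFibration q) : IsUniqueFibration (π ∘ q) where
  continuous := hπ.continuous.comp hq.continuous
  exists_lift H f h0 := by
    obtain ⟨H', hH', h0'⟩ := hπ.exists_lift H ((⟨q, hq.continuous⟩ : C(X, Y)).comp f) h0
    obtain ⟨H'', hH'', h0''⟩ := hq.exists_lift H' f h0'
    exact ⟨H'', fun z => by rw [Function.comp_apply, hH'', hH'], h0''⟩
  path_unique γ γ' h h0 := by
    let k : C(X, Y) := ⟨q, hq.continuous⟩
    have h1 := hπ.path_unique (k.comp γ) (k.comp γ') h (congrArg q h0)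
    exact hq.path_unique γ γ' (DFunLike.congr_fun h1) h0

theorem Homeomorph.isUniqueFibration (h : X ≃ₜ Y) : IsUniqueFibration h where
  continuous := h.continuous
  exists_lift H f h0 := ⟨⟨fun z => h.symm (H z), by fun_prop⟩, fun z => by simp,
    fun a => by simp [h0]⟩
  path_unique γ γ' h' _ := by
    ext t
    exact h.injective (h' t)

theorem IsCoveringMap.surjective_of_compactSpace [CompactSpace X] [Nonempty X] [T2Space Y]
    [PreconnectedSpace Y] {p : X → Y} (cov : IsCoveringMap p) : Function.Surjective p := by
  rw [← range_eq_univ]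
  exact IsClopen.eq_univ ⟨(isCompact_range cov.continuous).isClosed, cov.isOpenMap.isOpen_range⟩
    (range_nonempty p)

theorem IsCoveringMap.finite_fibre [CompactSpace X] [T1Space Y] {p : X → Y}
    (cov : IsCoveringMap p) (y : Y) : Finite ↥(p ⁻¹' {y}) := by
  have := (cov y).discreteTopology_fiber
  have : CompactSpace ↥(p ⁻¹' {y}) :=
    isCompact_iff_compactSpace.1 (isClosed_singleton.preimage cov.continuous).isCompact
  exact finite_of_compact_of_discrete

end

namespace CoveringTower

variable {n : ℕ} (P : CoveringTower.{u} n)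

instance (l : ℕ) : CompactSpace (P.M l) := (P.isClosedManifold l).compactSpace

instance (l : ℕ) : ConnectedSpace (P.M l) := (P.isClosedManifold l).connectedSpace

instance (l : ℕ) : T2Space (P.M l) := (P.isClosedManifold l).t2Space

/-- A choice of charts of a manifold in the tower. -/
noncomputable instance chartedSpace (l : ℕ) :
    ChartedSpace (EuclideanSpace ℝ (Fin n)) (P.M l) :=
  (P.isClosedManifold l).chartedSpace.some

instance (l : ℕ) : PathConnectedSpace (P.M l) := by
  have := ChartedSpace.locallyPathConnectedSpace (EuclideanSpace ℝ (Fin n)) (P.M l)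
  exact pathConnectedSpace_iff_connectedSpace.2 inferInstance

instance (l : ℕ) : SecondCountableTopology (P.M l) :=
  ChartedSpace.secondCountable_of_sigmaCompact (EuclideanSpace ℝ (Fin n)) (P.M l)

instance : T2Space P.Limit :=
  inferInstanceAs (T2Space {x : ∀ l, P.M l // ∀ l, P.p l (x (l + 1)) = x l})

instance : SecondCountableTopology P.Limit :=
  inferInstanceAs (SecondCountableTopology
    ↥{x : ∀ l, P.M l | ∀ l, P.p l (x (l + 1)) = x l})

instance : CompactSpace P.Limit := by
  refine isCompact_iff_compactSpace.1 (IsClosed.isCompact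
    (s := {x : ∀ l, P.M l | ∀ l, P.p l (x (l + 1)) = x l}) ?_)
  rw [ofPred_forall]
  exact isClosed_iInter fun l => isClosed_eq (by fun_prop) (by fun_prop)

instance : TopologicalSpace.MetrizableSpace P.Limit :=
  TopologicalSpace.metrizableSpace_of_t3_secondCountable _

variable {P} in
theorem continuous_coord (l : ℕ) : Continuous fun x : P.Limit => x.coord l :=
  (continuous_apply l).comp continuous_subtype_val

variable {P} in
theorem Limit.ext {x y : P.Limit} (h : ∀ l, x.coord l = y.coord l) : x = y :=
  Subtype.ext (funext h)

theorem p_coord (x : P.Limit) (l : ℕ) : P.p l (x.coord (l + 1)) = x.coord l :=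
  x.2 l

theorem surjective_p [Nonempty (P.M 0)] (l : ℕ) : Function.Surjective (P.p l) :=
  (P.isCoveringMap l).surjective_of_compactSpace

theorem isLocalHomeomorph_q (l : ℕ) : IsLocalHomeomorph (P.q l) := by
  induction l with
  | zero => exact (Homeomorph.refl (P.M 0)).isLocalHomeomorph
  | succ l ih => exact ih.comp (P.isCoveringMap l).isLocalHomeomorph

/-- Local homeomorphisms compose, and between compact Hausdorff spaces they are coverings. -/
theorem isCoveringMap_q (l : ℕ) : IsCoveringMap (P.q l) :=
  isLocalHomeomorph_iff_isCoveringMap.1 (P.isLocalHomeomorph_q l)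

/-- A homotopy is lifted through every `P.q l` separately; uniqueness of these lifts makes them
compatible with the bonding maps. -/
theorem isUniqueFibration_coord_zero : IsUniqueFibration fun x : P.Limit => x.coord 0 where
  continuous := continuous_coord 0
  exists_lift := by
    intro A _ H f h0
    have h0' : ∀ l a, H (0, a) = P.q l ((f a).coord l) := fun l a => by rw [P.q_coord, h0]
    let c : ∀ l, C(A, P.M l) := fun l => ⟨fun a => (f a).coord l,
      (continuous_coord l).comp f.continuous⟩
    let H' : ∀ l, C(I × A, P.M l) := fun l =>
      (P.isCoveringMap_q l).liftHomotopy H (c l) (h0' l)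
    have hH' : ∀ l z, P.q l (H' l z) = H z := fun l z =>
      congrFun ((P.isCoveringMap_q l).liftHomotopy_lifts H (c l) (h0' l)) z
    have hH'0 : ∀ l a, H' l (0, a) = (f a).coord l := fun l a =>
      (P.isCoveringMap_q l).liftHomotopy_zero H (c l) (h0' l) a
    have hp : ∀ l, (P.p l).comp (H' (l + 1)) = H' l := fun l => by
      refine ((P.isCoveringMap_q l).eq_liftHomotopy_iff' (h0' l) _).2 ⟨funext fun z => ?_, ?_⟩
      · exact hH' (l + 1) z
      · intro a
        rw [ContinuousMap.comp_apply, hH'0, P.p_coord]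
        rfl
    refine ⟨⟨fun z => ⟨fun l => H' l z, fun l => DFunLike.congr_fun (hp l) z⟩,
      (continuous_pi fun l => (H' l).continuous).subtype_mk _⟩, fun z => hH' 0 z, fun a => ?_⟩
    exact Limit.ext fun l => hH'0 l a
  path_unique := by
    intro γ γ' h h0
    ext t
    refine Limit.ext fun l => ?_
    refine congrFun ((P.isCoveringMap_q l).eq_of_comp_eq ((continuous_coord l).comp γ.continuous)
      ((continuous_coord l).comp γ'.continuous) (funext fun t => ?_) 0 ?_) t
    · simp only [Function.comp_apply, P.q_coord]
      exact h t
    · simp only [Function.comp_apply, h0]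

/-- A path in `P.M l` is projected to `P.M 0` and lifted to the limit; the `l`-th coordinate of the
lift is the original path. This makes leaves dense. -/
theorem exists_mem_pathComponent_coord_eq (z w : P.Limit) (l : ℕ) :
    ∃ w' ∈ pathComponent z, w'.coord l = w.coord l := by
  let β := PathConnectedSpace.somePath (z.coord l) (w.coord l)
  obtain ⟨Γ, hΓ, hΓ0⟩ := P.isUniqueFibration_coord_zero.exists_path_lift
    ((P.q l).comp β) z (by simp [P.q_coord])
  refine ⟨Γ 1, ⟨⟨Γ, hΓ0, rfl⟩⟩, ?_⟩
  have := (P.isCoveringMap_q l).eq_of_comp_eq ((continuous_coord l).comp Γ.continuous)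
    β.continuous (funext fun t => ?_) 0 ?_
  · simpa using congrFun this 1
  · simp only [Function.comp_apply, P.q_coord]
    exact hΓ t
  · simp [hΓ0]

theorem coord_eq_of_le {w w' : P.Limit} {l : ℕ} (h : w.coord l = w'.coord l) {i : ℕ}
    (hi : i ≤ l) : w.coord i = w'.coord i := by
  induction l, hi using Nat.le_induction with
  | base => exact h
  | succ l _ ih => exact ih (by rw [← P.p_coord w, ← P.p_coord w', h])

/-- A basic open set restricts finitely many coordinates, and the one of largest index determines
the others. -/
theorem exists_forall_coord_eq_mem (w : P.Limit) {O : Set P.Limit} (hO : IsOpen O) (hw : w ∈ O) :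
    ∃ l, ∀ w' : P.Limit, w'.coord l = w.coord l → w' ∈ O := by
  obtain ⟨O', hO', rfl⟩ := isOpen_induced_iff.1 hO
  obtain ⟨F, U, hU, hUO⟩ := isOpen_pi_iff.1 hO' w.1 hw
  refine ⟨F.sup id, fun w' h => hUO fun i hi => ?_⟩
  have h1 : w'.1 i = w.1 i := P.coord_eq_of_le h (Finset.le_sup (f := id) hi)
  rw [h1]
  exact (hU i hi).2

theorem dense_pathComponent (z : P.Limit) : Dense (pathComponent z) := by
  rw [dense_iff_inter_open]
  rintro O hO ⟨w, hw⟩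
  obtain ⟨l, hl⟩ := P.exists_forall_coord_eq_mem w hO hw
  obtain ⟨w', hw', h⟩ := P.exists_mem_pathComponent_coord_eq z w l
  exact ⟨w', hl w' h, hw'⟩

theorem connectedSpace_limit (z : P.Limit) : ConnectedSpace P.Limit where
  isPreconnected_univ := by
    rw [← (P.dense_pathComponent z).closure_eq]
    exact isPathConnected_pathComponent.isConnected.isPreconnected.closure
  toNonempty := ⟨z⟩

/-! ### The tower of the Galois closures -/

variable (x : P.Limit)

/-- The `l`-th coordinate of the base point, as a point of the fibre of `P.q l`. -/
def fibrePoint (l : ℕ) : ↥(P.q l ⁻¹' {x.coord 0}) :=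
  ⟨x.coord l, P.q_coord x l⟩

instance (l : ℕ) : Finite ↥(P.q l ⁻¹' {x.coord 0}) :=
  (P.isCoveringMap_q l).finite_fibre _

instance (l : ℕ) : CompactSpace (GaloisClosure (P.q l) (x.coord 0)) :=
  GaloisClosure.compactSpace (EuclideanSpace ℝ (Fin n)) (P.isLocalHomeomorph_q l)
    (P.fibrePoint x l)

/-- The projection of the Galois closure of `P.q l` to `P.M l`. -/
def galoisProj (l : ℕ) : C(GaloisClosure (P.q l) (x.coord 0), P.M l) :=
  GaloisClosure.eval (P.fibrePoint x l)

theorem isLocalHomeomorph_q_comp_galoisProj (l : ℕ) :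
    IsLocalHomeomorph ((P.q l).comp (P.galoisProj x l)) :=
  GaloisClosure.isLocalHomeomorph (EuclideanSpace ℝ (Fin n)) (P.isLocalHomeomorph_q l)
    (P.fibrePoint x l)

theorem isCoveringMap_q_comp_galoisProj (l : ℕ) :
    IsCoveringMap ((P.q l).comp (P.galoisProj x l)) :=
  isLocalHomeomorph_iff_isCoveringMap.1 (P.isLocalHomeomorph_q_comp_galoisProj x l)

/-- The map between successive Galois closures. -/
noncomputable def galoisMap (l : ℕ) :
    C(GaloisClosure (P.q (l + 1)) (x.coord 0), GaloisClosure (P.q l) (x.coord 0)) :=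
  GaloisClosure.map (P.isCoveringMap_q l) (P.isCoveringMap_q (l + 1)) (P.p l) (fun _ => rfl)
    (have : Nonempty (P.M 0) := ⟨x.coord 0⟩; P.surjective_p l) (P.fibrePoint x (l + 1))

theorem galoisProj_galoisMap (l : ℕ) (f : GaloisClosure (P.q (l + 1)) (x.coord 0)) :
    P.galoisProj x l (P.galoisMap x l f) = P.p l (P.galoisProj x (l + 1) f) := by
  have h : P.fibrePoint x l =
      GaloisClosure.fibreMap (P.p l) (fun _ => rfl) (P.fibrePoint x (l + 1)) :=
    Subtype.ext (P.p_coord x l).symm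
  rw [galoisProj, h]
  exact GaloisClosure.eval_map _ _ _ _ _ _ f (P.fibrePoint x (l + 1))

/-- The tower of the Galois closures of the coverings `P.q l`. -/
noncomputable def galoisTower : CoveringTower.{u} n where
  M l := GaloisClosure (P.q l) (x.coord 0)
  isClosedManifold l :=
    { compactSpace := inferInstance
      connectedSpace := inferInstance
      t2Space := inferInstance
      chartedSpace := ⟨(P.isLocalHomeomorph_q_comp_galoisProj x l).chartedSpaceOfBase⟩ }
  p := P.galoisMap x
  isCoveringMap l := by
    rw [← isLocalHomeomorph_iff_isCoveringMap]
    -- Followed by the local homeomorphism to `P.M 0`, the map becomes the projection of level `l +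
    -- 1`, again a local homeomorphism.
    refine IsLocalHomeomorph.of_comp (g := (P.q l).comp (P.galoisProj x l)) ?_
      (P.isLocalHomeomorph_q_comp_galoisProj x l) (P.galoisMap x l).continuous
    convert P.isLocalHomeomorph_q_comp_galoisProj x (l + 1) using 1
    ext f
    exact congrArg (P.q l) (P.galoisProj_galoisMap x l f)

/-- The base point of the limit of the Galois closures. -/
noncomputable def galoisBase : (P.galoisTower x).Limit :=
  ⟨fun l => GaloisClosure.base (P.q l) (x.coord 0), fun l =>
    GaloisClosure.map_base (P.isCoveringMap_q l) (P.isCoveringMap_q (l + 1)) (P.p l) (fun _ => rfl)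
      (have : Nonempty (P.M 0) := ⟨x.coord 0⟩; P.surjective_p l) (P.fibrePoint x (l + 1))⟩

theorem isCoveringMap_galoisProj (l : ℕ) : IsCoveringMap (P.galoisProj x l) :=
  isLocalHomeomorph_iff_isCoveringMap.1 <|
    IsLocalHomeomorph.of_comp (g := P.q l) (P.isLocalHomeomorph_q_comp_galoisProj x l)
      (P.isLocalHomeomorph_q l) (P.galoisProj x l).continuous

theorem normalCore_groupChain (l : ℕ) :
    (P.groupChain x l).normalCore = ((P.isCoveringMap_q l).monodromyPerm (x.coord 0)).ker :=
  (P.isCoveringMap_q l).normalCore_range_mapOfEq (fun _ => rfl) (P.q_coord x l)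

theorem isCoreTower_galoisTower :
    IsCoreTower P x (P.galoisTower x) (P.galoisBase x) (P.galoisProj x) where
  isCoveringMap := P.isCoveringMap_galoisProj x
  comm l f := P.galoisProj_galoisMap x l f
  base _ := rfl
  range_eq l := by
    rw [normalCore_groupChain]
    exact GaloisClosure.range_mapOfEq (P.isCoveringMap_q l) (P.fibrePoint x l)
      (f := (P.q l).comp (P.galoisProj x l))
      (P.isCoveringMap_q_comp_galoisProj x l) (fun _ => rfl) _

end CoveringTower

/-! ### The topology of the discriminant group -/

namespace Discriminant

variable {Γ : Type u} [Group Γ] (G : ℕ → Subgroup Γ)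

instance : IsTopologicalGroup (Discriminant G) :=
  letI (l : ℕ) : TopologicalSpace (Γ ⧸ (G l).normalCore) := ⊥
  haveI (l : ℕ) : DiscreteTopology (Γ ⧸ (G l).normalCore) := ⟨rfl⟩
  inferInstanceAs (IsTopologicalGroup (discriminantSubgroup G))

instance : T2Space (Discriminant G) :=
  letI (l : ℕ) : TopologicalSpace (Γ ⧸ (G l).normalCore) := ⊥
  haveI (l : ℕ) : DiscreteTopology (Γ ⧸ (G l).normalCore) := ⟨rfl⟩
  inferInstanceAs (T2Space (discriminantSubgroup G))

instance : TotallyDisconnectedSpace (Discriminant G) :=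
  letI (l : ℕ) : TopologicalSpace (Γ ⧸ (G l).normalCore) := ⊥
  haveI (l : ℕ) : DiscreteTopology (Γ ⧸ (G l).normalCore) := ⟨rfl⟩
  inferInstanceAs (TotallyDisconnectedSpace (discriminantSubgroup G))

theorem compactSpace [∀ l, Finite (Γ ⧸ (G l).normalCore)] : CompactSpace (Discriminant G) := by
  let (l : ℕ) : TopologicalSpace (Γ ⧸ (G l).normalCore) := ⊥
  have (l : ℕ) : DiscreteTopology (Γ ⧸ (G l).normalCore) := ⟨rfl⟩
  suffices h : IsClosed (discriminantSubgroup G : Set (∀ l, Γ ⧸ (G l).normalCore)) from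
    isCompact_iff_compactSpace.1 h.isCompact
  refine IsClosed.inter ?_ ?_
  · have : (coreLimit G : Set (∀ l, Γ ⧸ (G l).normalCore)) =
        ⋂ l, (fun c : ∀ l, Γ ⧸ (G l).normalCore => (c (l + 1), c l)) ⁻¹'
          {c | ∃ g : Γ, c.1 = g ∧ c.2 = g} := by
      ext c
      simp only [mem_iInter]
      rfl
    refine this.symm ▸ isClosed_iInter fun l => (isClosed_discrete _).preimage (by fun_prop)
  · exact isClosed_set_pi fun l _ => isClosed_discrete _

variable {G}

/-- The inclusion of the discriminant group in the inverse limit of the quotients by the cores. -/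
def toCoreLimit : Discriminant G →* coreLimit G :=
  Subgroup.inclusion inf_le_left

theorem isOpen_setOf_coord_eq (l : ℕ) (s : Γ ⧸ (G l).normalCore) :
    IsOpen {d : Discriminant G | (toCoreLimit d).1 l = s} := by
  let (l : ℕ) : TopologicalSpace (Γ ⧸ (G l).normalCore) := ⊥
  have (l : ℕ) : DiscreteTopology (Γ ⧸ (G l).normalCore) := ⟨rfl⟩
  have h : Continuous fun d : discriminantSubgroup G => d.1 l :=
    (continuous_apply l).comp continuous_subtype_val
  exact (isOpen_discrete {s}).preimage h

end Discriminant

namespace CoveringTower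

variable {n : ℕ} (P : CoveringTower.{u} n) (x : P.Limit)

/-! ### The action on the limit of the Galois closures -/

/-- The action of the quotient by a core on a fibre of the covering. -/
noncomputable def coreToPerm (l : ℕ) :
    FundamentalGroup (P.M 0) (x.coord 0) ⧸ (P.groupChain x l).normalCore →*
      ((P.isCoveringMap_q l).monodromyPerm (x.coord 0)).range :=
  QuotientGroup.lift _ ((P.isCoveringMap_q l).monodromyPerm (x.coord 0)).rangeRestrict <| by
    rw [normalCore_groupChain, MonoidHom.ker_rangeRestrict]

theorem injective_coreToPerm (l : ℕ) : Function.Injective (P.coreToPerm x l) := by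
  rw [injective_iff_map_eq_one]
  intro c hc
  obtain ⟨g, rfl⟩ := QuotientGroup.mk_surjective c
  rw [QuotientGroup.eq_one_iff, normalCore_groupChain]
  exact congrArg Subtype.val hc

instance (l : ℕ) :
    Finite (FundamentalGroup (P.M 0) (x.coord 0) ⧸ (P.groupChain x l).normalCore) :=
  Finite.of_injective _ (P.injective_coreToPerm x l)

/-- The stabilizer of `x l` under monodromy is the group `G l`; this ties the algebraic discriminant
to the geometry of the fibres. -/
theorem coreToPerm_fibrePoint_eq_iff (l : ℕ)
    (c : FundamentalGroup (P.M 0) (x.coord 0) ⧸ (P.groupChain x l).normalCore) :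
    (P.coreToPerm x l c).1 (P.fibrePoint x l) = P.fibrePoint x l ↔
      c ∈ (P.groupChain x l).map (QuotientGroup.mk' (P.groupChain x l).normalCore) := by
  have key : ∀ g, (P.coreToPerm x l (g : FundamentalGroup (P.M 0) (x.coord 0))).1
      (P.fibrePoint x l) = P.fibrePoint x l ↔ g ∈ P.groupChain x l := fun g =>
    ((P.isCoveringMap_q l).mem_range_mapOfEq_iff (fun _ => rfl) (P.q_coord x l)
      (P.q_coord x l) g).symm
  constructor
  · obtain ⟨g, rfl⟩ := QuotientGroup.mk_surjective c
    exact fun h => ⟨g, (key g).1 h, rfl⟩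
  · rintro ⟨g, hg, rfl⟩
    exact (key g).2 hg

theorem galoisMap_reindex (l : ℕ) (f : GaloisClosure (P.q (l + 1)) (x.coord 0))
    (g : FundamentalGroup (P.M 0) (x.coord 0)) :
    P.galoisMap x l (GaloisClosure.reindex (P.isCoveringMap_q (l + 1))
      (P.coreToPerm x (l + 1) g) f) =
      GaloisClosure.reindex (P.isCoveringMap_q l) (P.coreToPerm x l g) (P.galoisMap x l f) :=
  GaloisClosure.map_reindex (P.isCoveringMap_q l) (P.isCoveringMap_q (l + 1)) (P.p l)
    (fun _ => rfl) (have : Nonempty (P.M 0) := ⟨x.coord 0⟩; P.surjective_p l)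
    (P.fibrePoint x (l + 1)) f g

/-- The action is coordinatewise. It respects the bonding maps because consecutive terms of `c` have
a common representative `g` and `galoisMap` is equivariant for loops. -/
noncomputable instance : MulAction (coreLimit (P.groupChain x)) (P.galoisTower x).Limit where
  smul c w := ⟨fun l => GaloisClosure.reindex (P.isCoveringMap_q l)
    (P.coreToPerm x l (c.1 l)) (w.coord l), fun l => by
      obtain ⟨g, h1, h2⟩ := c.2 l
      exact (congrArg (fun s => P.galoisMap x l (GaloisClosure.reindex _
        (P.coreToPerm x (l + 1) s) (w.coord (l + 1)))) h1).trans <|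
        (P.galoisMap_reindex x l _ g).trans <|
        congrArg₂ (fun s f => GaloisClosure.reindex _ (P.coreToPerm x l s) f) h2.symm
          ((P.galoisTower x).p_coord w l)⟩
  one_smul w := Limit.ext fun l => by
    refine (congrArg (fun s => GaloisClosure.reindex (P.isCoveringMap_q l) s (w.coord l))
      (map_one (P.coreToPerm x l))).trans ?_
    exact GaloisClosure.reindex_one _ _
  mul_smul c c' w := Limit.ext fun l => by
    refine (congrArg (fun s => GaloisClosure.reindex (P.isCoveringMap_q l) s (w.coord l))
      (map_mul (P.coreToPerm x l) (c.1 l) (c'.1 l))).trans ?_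
    exact GaloisClosure.reindex_mul _ _ _ _

noncomputable instance : MulAction (Discriminant (P.groupChain x)) (P.galoisTower x).Limit :=
  MulAction.compHom _ Discriminant.toCoreLimit

instance : ContinuousConstSMul (coreLimit (P.groupChain x)) (P.galoisTower x).Limit where
  continuous_const_smul c := (continuous_pi fun l =>
    (GaloisClosure.continuous_reindex (P.isCoveringMap_q l) (P.coreToPerm x l (c.1 l))).comp
      (continuous_coord l)).subtype_mk _

instance : ContinuousSMul (Discriminant (P.groupChain x)) (P.galoisTower x).Limit where
  continuous_smul := by
    refine (continuous_pi fun l => ?_).subtype_mk _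
    refine continuous_iff_continuousAt.2 ?_
    rintro ⟨d, w⟩
    have h : Continuous fun z : Discriminant (P.groupChain x) × (P.galoisTower x).Limit =>
        GaloisClosure.reindex (P.isCoveringMap_q l)
          (P.coreToPerm x l ((Discriminant.toCoreLimit d).1 l)) (z.2.coord l) :=
      (GaloisClosure.continuous_reindex _ _).comp ((continuous_coord l).comp continuous_snd)
    refine h.continuousAt.congr ?_
    -- For group elements near `d` the `l`-th term is that of `d`, so the `l`-th coordinate of the
    -- action is locally a fixed reindexing.
    filter_upwards [((Discriminant.isOpen_setOf_coord_eq l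
      ((Discriminant.toCoreLimit d).1 l)).preimage continuous_fst).mem_nhds
        (x := (d, w)) rfl] with z hz
    have hz : (Discriminant.toCoreLimit z.1).1 l = (Discriminant.toCoreLimit d).1 l := hz
    rw [← hz]

/-! ### Fibres and local sections of the limit map -/

/-- The limit of the projections of the Galois closures. -/
noncomputable def galoisLimitMap : C((P.galoisTower x).Limit, P.Limit) where
  toFun w := ⟨fun l => P.galoisProj x l (w.coord l), fun l =>
    (P.galoisProj_galoisMap x l (w.coord (l + 1))).symm.trans
      (congrArg (P.galoisProj x l) ((P.galoisTower x).p_coord w l))⟩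
  continuous_toFun := (continuous_pi fun l =>
    (P.galoisProj x l).continuous.comp (continuous_coord l)).subtype_mk _

theorem isUniqueFibration_galoisLimitMap_coord_zero :
    IsUniqueFibration fun w => (P.galoisLimitMap x w).coord 0 :=
  (P.isCoveringMap_galoisProj x 0).isUniqueFibration.comp
    (P.galoisTower x).isUniqueFibration_coord_zero

theorem eq_of_smul_eq_smul {c c' : coreLimit (P.groupChain x)} {w : (P.galoisTower x).Limit}
    (h : c • w = c' • w) : c = c' :=
  Subtype.ext <| funext fun l => P.injective_coreToPerm x l <|
    GaloisClosure.reindex_left_injective (P.isCoveringMap_q l) (congrArg (fun w => w.coord l) h)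

/-- Regularity at each level gives a loop `g l`. Reindexing is free, so `g l` is unique modulo the
core, and equivariance forces the cosets of successive levels to match. -/
theorem exists_smul_eq_of_coord_zero {w w' : (P.galoisTower x).Limit}
    (h : (P.galoisLimitMap x w).coord 0 = (P.galoisLimitMap x w').coord 0) :
    ∃ c : coreLimit (P.groupChain x), c • w = w' := by
  have h1 : ∀ l, ∃ g : FundamentalGroup (P.M 0) (x.coord 0),
      GaloisClosure.reindex (P.isCoveringMap_q l) (P.coreToPerm x l g) (w.coord l) =
        w'.coord l := fun l => by
    rw [← P.q_coord (P.galoisLimitMap x w) l, ← P.q_coord (P.galoisLimitMap x w') l] at h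
    obtain ⟨⟨_, g, rfl⟩, hg⟩ := GaloisClosure.exists_reindex_eq (P.isCoveringMap_q l)
      (P.fibrePoint x l) (f := w.coord l) (f' := w'.coord l) h
    exact ⟨g, hg⟩
  choose g hg using h1
  refine ⟨⟨fun l => g l, fun l => ⟨g (l + 1), rfl, P.injective_coreToPerm x l <|
    GaloisClosure.reindex_left_injective (P.isCoveringMap_q l) (f := w.coord l) ?_⟩⟩,
    Limit.ext hg⟩
  rw [hg l, ← (P.galoisTower x).p_coord w' l, ← (P.galoisTower x).p_coord w l, ← hg (l + 1)]
  exact P.galoisMap_reindex x l _ _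

/-- Points over one point of `P.M 0` differ by some `c` in `coreLimit`. Evaluation of a tuple is
injective, so their images in `P.M l` agree exactly if the `l`-th term of `c` fixes `x l`, that is,
lies in `G l ⧸ C l`. -/
theorem galoisLimitMap_eq_iff (w w' : (P.galoisTower x).Limit) :
    P.galoisLimitMap x w = P.galoisLimitMap x w' ↔
      ∃ d : Discriminant (P.groupChain x), d • w = w' := by
  constructor
  · intro h
    obtain ⟨c, rfl⟩ := P.exists_smul_eq_of_coord_zero x (congrArg (fun y => y.coord 0) h)
    refine ⟨⟨c.1, c.2, fun l _ => (P.coreToPerm_fibrePoint_eq_iff x l _).1 ?_⟩, rfl⟩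
    rw [← Equiv.Perm.eq_inv_iff_eq]
    exact GaloisClosure.injective_eval (P.isCoveringMap_q l) (w.coord l)
      (congrArg (fun y => y.coord l) h)
  · rintro ⟨d, rfl⟩
    refine Limit.ext fun l => ?_
    have h := (P.coreToPerm_fibrePoint_eq_iff x l (d.1 l)).2 (d.2.2 l trivial)
    rw [← Equiv.Perm.eq_inv_iff_eq] at h
    exact congrArg (fun a => GaloisClosure.eval a (w.coord l)) h

/-- The image is compact and contains a leaf of the solenoid, which is dense. -/
theorem surjective_galoisLimitMap : Function.Surjective (P.galoisLimitMap x) := by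
  rw [← range_eq_univ, ← (isCompact_range (P.galoisLimitMap x).continuous).isClosed.closure_eq,
    ← dense_iff_closure_eq]
  refine (P.dense_pathComponent (P.galoisLimitMap x (P.galoisBase x))).mono fun y hy => ?_
  obtain ⟨w, hw⟩ := (P.isUniqueFibration_galoisLimitMap_coord_zero x).surjective_leafMap
    P.isUniqueFibration_coord_zero (P.galoisLimitMap x) (fun _ => rfl) (P.galoisBase x) ⟨y, hy⟩
  exact ⟨w.1, congrArg Subtype.val hw⟩

theorem isOpenMap_galoisLimitMap : IsOpenMap (P.galoisLimitMap x) :=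
  isOpenMap_of_fibres_eq_orbits (D := Discriminant (P.groupChain x))
    (P.galoisLimitMap x).continuous (P.surjective_galoisLimitMap x) (P.galoisLimitMap_eq_iff x)

/-- Upstairs, the fibre over `b` is embedded in the limit of the finite fibres of the Galois
closures, and the restricted map is an open surjection. -/
theorem exists_fibre_section (b : P.M 0) :
    ∃ s : C((fun y : P.Limit => y.coord 0) ⁻¹' {b}, (P.galoisTower x).Limit),
      ∀ y, P.galoisLimitMap x (s y) = y := by
  let Y : Set P.Limit := (fun y : P.Limit => y.coord 0) ⁻¹' {b}
  let π : ∀ l, C(GaloisClosure (P.q l) (x.coord 0), P.M 0) :=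
    fun l => (P.q l).comp (P.galoisProj x l)
  have hmem : ∀ (w : ↥(P.galoisLimitMap x ⁻¹' Y)) (l : ℕ), w.1.coord l ∈ π l ⁻¹' {b} :=
    fun w l => (P.q_coord (P.galoisLimitMap x w.1) l).trans w.2
  have hY : IsClosed Y := isClosed_singleton.preimage (continuous_coord 0)
  have := isCompact_iff_compactSpace.1
    (hY.preimage (P.galoisLimitMap x).continuous).isCompact
  have (l : ℕ) : DiscreteTopology ↥(π l ⁻¹' {b}) :=
    (P.isCoveringMap_q_comp_galoisProj x l b).discreteTopology_fiber
  have (l : ℕ) : Finite ↥(π l ⁻¹' {b}) := (P.isCoveringMap_q_comp_galoisProj x l).finite_fibre b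
  obtain ⟨s, hs⟩ := exists_continuous_section_of_isOpenMap
    (q := Y.restrictPreimage (P.galoisLimitMap x)) (A := fun l => ↥(π l ⁻¹' {b}))
    (P.galoisLimitMap x).continuous.restrictPreimage
    ((P.isOpenMap_galoisLimitMap x).restrictPreimage Y)
    ((P.surjective_galoisLimitMap x).restrictPreimage Y)
    (fun l w => ⟨w.1.coord l, hmem w l⟩)
    (fun l => ((continuous_coord l).comp continuous_subtype_val).subtype_mk _)
    (fun l f => ⟨P.galoisMap x l f.1, by
      refine (congrArg (P.q l) (P.galoisProj_galoisMap x l f.1)).trans f.2⟩)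
    (fun l w => Subtype.ext ((P.galoisTower x).p_coord w.1 l))
    (fun w w' h => Subtype.ext (Limit.ext fun l => congrArg Subtype.val (h l)))
  exact ⟨⟨fun y => (s y).1, by fun_prop⟩, fun y => congrArg Subtype.val (hs y)⟩

theorem exists_local_section (y : P.Limit) :
    ∃ V : Set P.Limit, IsOpen V ∧ y ∈ V ∧
      ∃ s : C(V, (P.galoisTower x).Limit), ∀ v, P.galoisLimitMap x (s v) = v := by
  obtain ⟨N, -, hN⟩ := exists_isContractibleNhd_of_chartedSpace (E := EuclideanSpace ℝ (Fin n))
    (y.coord 0) Filter.univ_mem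
  obtain ⟨s, hs⟩ := P.exists_fibre_section x (y.coord 0)
  exact ⟨_, hN.isOpen.preimage (continuous_coord 0), hN.mem,
    (P.isUniqueFibration_galoisLimitMap_coord_zero x).exists_local_section
      P.isUniqueFibration_coord_zero (P.galoisLimitMap x) (fun _ => rfl) hN s hs⟩

theorem isPrincipalBundle_galoisLimitMap {Y : Type u} [TopologicalSpace Y] (h : Y ≃ₜ P.Limit) :
    IsPrincipalBundle (Discriminant (P.groupChain x)) (h.symm ∘ P.galoisLimitMap x) := by
  have := Discriminant.compactSpace (P.groupChain x)
  refine IsPrincipalBundle.of_local_sections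
    (h.symm.continuous.comp (P.galoisLimitMap x).continuous) (fun w w' => ?_)
    (fun d d' w hw => ?_) (fun y => ?_)
  · rw [← galoisLimitMap_eq_iff]
    exact h.symm.injective.eq_iff
  · exact Subgroup.inclusion_injective _ (P.eq_of_smul_eq_smul x hw)
  · obtain ⟨V, hV, hyV, s, hs⟩ := P.exists_local_section x (h y)
    refine ⟨h ⁻¹' V, hV.preimage h.continuous, hyV,
      s.comp ⟨V.restrictPreimage h, h.continuous.restrictPreimage⟩, fun v => ?_⟩
    exact (congrArg h.symm (hs _)).trans (h.symm_apply_apply v.1)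

theorem isHomogeneousSpace_limit_galoisTower : IsHomogeneousSpace (P.galoisTower x).Limit := by
  have := (P.galoisTower x).connectedSpace_limit (P.galoisBase x)
  refine (P.isUniqueFibration_galoisLimitMap_coord_zero x).isHomogeneousSpace
    (exists_homotopy_moving_of_chartedSpace (E := EuclideanSpace ℝ (Fin n))) fun w w' h => ?_
  obtain ⟨c, hc⟩ := P.exists_smul_eq_of_coord_zero x h
  exact ⟨Homeomorph.smul c, hc⟩

end CoveringTower

/-! ### Assembly of the theorem -/

theorem mainTheorem1 {n : ℕ} {𝔐 : Type u} [TopologicalSpace 𝔐] (hM : IsMatchboxManifold n 𝔐)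
    (P : Presentation.{u} n) (h : 𝔐 ≃ₜ P.Limit) (x : P.Limit) :
    (IsTopologicalGroup (Discriminant (P.groupChain x)) ∧
      CompactSpace (Discriminant (P.groupChain x)) ∧
      T2Space (Discriminant (P.groupChain x)) ∧
      TotallyDisconnectedSpace (Discriminant (P.groupChain x))) ∧
    ∃ (Q : CoveringTower.{u} n) (z : Q.Limit) (r : ∀ l, C(Q.M l, P.M l)),
      IsCoreTower P.toCoveringTower x Q z r ∧
      IsMatchboxManifold n Q.Limit ∧
      IsHomogeneousSpace Q.Limit ∧
      ∃ qhat : C(Q.Limit, 𝔐),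
        (∀ w l, (h (qhat w)).coord l = r l (w.coord l)) ∧
        (∃ _ : MulAction (Discriminant (P.groupChain x)) Q.Limit,
          IsPrincipalBundle (Discriminant (P.groupChain x)) qhat) ∧
        ∀ w : Q.Limit,
          IsCoveringMap (leafMap qhat w) ∧ Function.Surjective (leafMap qhat w) := by
  obtain ⟨P, -⟩ := P
  have := Discriminant.compactSpace (P.groupChain x)
  have hconn := (P.galoisTower x).connectedSpace_limit (P.galoisBase x)
  have hbundle := P.isPrincipalBundle_galoisLimitMap x h
  have hX := P.isUniqueFibration_galoisLimitMap_coord_zero x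
  -- Through `h`, the space `𝔐` is itself a fibration over `P.M 0`, so `qhat` is a map over this
  -- common base.
  have hY := P.isUniqueFibration_coord_zero.comp h.isUniqueFibration
  let qhat : C((P.galoisTower x).Limit, 𝔐) := (h.symm : C(P.Limit, 𝔐)).comp (P.galoisLimitMap x)
  have hh : ∀ w, h (qhat w) = P.galoisLimitMap x w := fun w => h.apply_symm_apply _
  have hq : ∀ w, (h (qhat w)).coord 0 = (P.galoisLimitMap x w).coord 0 := fun w => by rw [hh]
  refine ⟨⟨inferInstance, this, inferInstance, inferInstance⟩, P.galoisTower x, P.galoisBase x,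
    P.galoisProj x, P.isCoreTower_galoisTower x, ?_, P.isHomogeneousSpace_limit_galoisTower x,
    qhat, fun w l => by rw [hh]; rfl, ⟨inferInstance, hbundle⟩, fun w => ⟨?_, ?_⟩⟩
  · exact hM.of_trivialization inferInstance hconn inferInstance _ fun y =>
      (hbundle.exists_trivialization y).imp fun e he => he.1
  · exact IsUniqueFibration.isCoveringMap_leafMap
      (fun b _ hW => exists_isContractibleNhd_of_chartedSpace
        (E := EuclideanSpace ℝ (Fin n)) b hW) hX hY qhat hq w
  · exact hX.surjective_leafMap hY qhat hq w
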